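/- Let $N\ge 1$ and $d\ge 0$. For Lebesgue-almost every dataset $X=(x_1,\dots,x_N)\in(\mathbb{R}^d)^N$ (labels absorbed into the points) the following holds. Suppose that $X$ is strictly linearly separable, i.e. $w_*^\top x_n>0$ for all $n$ and some $w_*$. Let $\gamma=\max_{\|w\|=1}\min_n w^\top x_n$ be its margin and $\sigma_{\max}$ the largest singular value of the matrix with columns $x_n$. Then there is a unique max-margin separator $\hat w=\mathrm{argmin}\{\|w\|^2: w^\top x_n\ge 1\ \forall n\}$; put $\mathcal S=\{n:\hat w^\top x_n=1\}$. There are unique dual variables $\alpha_n\ge 0$, with $\alpha_n=0$ for $n\notin\mathcal S$, such that $\hat w=\sum_{n\in\mathcal S}\alpha_n x_n$. Assume moreover that the support vectors span the data: $\mathrm{rank}\{x_n\}_{n\in\mathcal S}=\mathrm{rank}\{x_n\}_{n\le N}$. Then for every starting point $w(0)\in\mathbb{R}^d$ there is a unique $\tilde w$, depending only on $X$ and $w(0)$, with $$\exp(-x_n^\top\tilde w)=\alpha_n\ \ (n\in\mathcal S),\qquad (I-P)(\tilde w-w(0))=0,$$ where $P$ is the orthogonal projection onto $\mathrm{span}\{x_n\}_{n\in\mathcal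 S}$, and it has the following properties. Let $\ell:\mathbb{R}\to\mathbb{R}$ be positive and differentiable, with $\ell'$ $\beta$-Lipschitz, $\ell'<0$, $\ell(u)\to0$ and $\ell'(u)\to0$ as $u\to\infty$, and $\limsup_{u\to-\infty}\ell'(u)\ne0$. Suppose that $-\ell'$ has a tight exponential tail: for some $\mu_+,\mu_-,\bar u>0$, $(1-e^{-\mu_-u})e^{-u}\le-\ell'(u)\le(1+e^{-\mu_+u})e^{-u}$ for all $u>\bar u$. Let $B,K\ge1$ be integers with $BK=N$, let $\eta>0$, and let $$w(t+1)=w(t)-\frac{\eta}{B}\sum_{n\in\mathcal B(t)}\ell'(w(t)^\top x_n)\,x_n ,\qquad |\mathcal B(t)|=B,$$ where one of the following holds. Case 1 (with replacement): the minibatches $\mathcal B(t)$ are random and independent over $t$, each sample has the same probability to belong to $\mathcal B(t)$, and $\frac{\eta}{B}<\frac{2\gamma^2}{\beta\sigma_{\max}^4}$. Case 2 (without replacement): for every $u\ge0$ the minibatches $\mathcal B(Ku),\dots,\mathcal B(Ku+K-1)$ partition $\{1,\dots,N\}$ (and are otherwise arbitrary), and $\frac{\eta}{B}<\min\left[\frac{1}{2K\beta\sigma_{\max}^2},\frac{\gamma}{2\beta\sigma_{\max}^3(K+\gamma^{-1}\sigma_{\max})}\right]$.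 Then, almost surely in Case 1 and surely in Case 2, as $t\to\infty$, $$w(t)=\hat w\,\log\left(\frac{\eta}{B}\cdot\frac tK\right)+\tilde w+o(1),$$ with the above $\tilde w$, which does not depend on $K$, $\eta$ or $B$. Hence, if two such runs $w_1,w_2$ with the same $\ell$, $\beta$ and $w(0)$ have parameters $(\eta_i,B_i,K_i)$ with $\eta_1/B_1=\eta_2/B_2$, then $w_1(\lfloor K_1\tau\rfloor)-w_2(\lfloor K_2\tau\rfloor)\to0$ as the number of epochs $\tau\in\mathbb{R}$ tends to infinity (surely if both runs are in Case 2, almost surely otherwise, for runs on a common probability space). That is, changing the number of minibatches is asymptotically only a linear rescaling of time. -/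

import Mathlib

open Filter Topology MeasureTheory ProbabilityTheory
open scoped NNReal

noncomputable section

namespace MinibatchSGD

/-- A dataset of `N` points in `ℝ^d`, the labels being absorbed into the points. It carries the
Lebesgue measure of `(ℝ^d)^N`. -/
abbrev Dataset (N d : ℕ) : Type := Fin N → EuclideanSpace ℝ (Fin d)

variable {N d : ℕ}

/-- Strict linear separability. -/
def LinearlySeparable (X : Dataset N d) : Prop :=
  ∃ w : EuclideanSpace ℝ (Fin d), ∀ n, 0 < inner ℝ w (X n)

/-- The maximal `L₂` margin `γ = max_{‖w‖ = 1} min_n wᵀ x_n`. -/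
def margin (X : Dataset N d) : ℝ :=
  sSup {m : ℝ | ∃ w : EuclideanSpace ℝ (Fin d), ‖w‖ = 1 ∧ m = ⨅ n, inner ℝ w (X n)}

/-- The data matrix, whose columns are the samples, as a map `v ↦ ∑ n, v_n x_n` between Euclidean
spaces. -/
def dataMap (X : Dataset N d) : EuclideanSpace ℝ (Fin N) →L[ℝ] EuclideanSpace ℝ (Fin d) :=
  ∑ n, (EuclideanSpace.proj n : EuclideanSpace ℝ (Fin N) →L[ℝ] ℝ).smulRight (X n)

/-- The maximal singular value of the data matrix, i.e. its `L₂` operator norm. -/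
def sigmaMax (X : Dataset N d) : ℝ := ‖dataMap X‖

/-- Positive, differentiable, `β`-smooth loss, strictly decreasing to zero, whose derivative does
not vanish in the upper limit at `-∞`. The upper limit is taken in the extended reals, because the
derivative may tend to `-∞`. -/
structure IsSmoothMonotoneLoss (ℓ : ℝ → ℝ) (β : ℝ≥0) : Prop where
  differentiable : Differentiable ℝ ℓ
  smooth : LipschitzWith β (deriv ℓ)
  pos : ∀ u, 0 < ℓ u
  deriv_neg : ∀ u, deriv ℓ u < 0
  tendsto_zero : Tendsto ℓ atTop (𝓝 0)
  deriv_tendsto_zero : Tendsto (deriv ℓ) atTop (𝓝 0)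
  limsup_ne : limsup (fun u => ((deriv ℓ u : ℝ) : EReal)) atBot ≠ 0

/-- Tight exponential tail. -/
def HasTightExpTail (f : ℝ → ℝ) : Prop :=
  ∃ μp μm ubar : ℝ, 0 < μp ∧ 0 < μm ∧ 0 < ubar ∧ ∀ u, ubar < u →
    (1 - Real.exp (-μm * u)) * Real.exp (-u) ≤ f u ∧
    f u ≤ (1 + Real.exp (-μp * u)) * Real.exp (-u)

/-- The iterates of minibatch SGD,
`w(t+1) = w(t) - (η/B) ∑_{n ∈ 𝓑(t)} ℓ'(w(t)ᵀ x_n) x_n`, from the starting point `w0`. -/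
def sgd (X : Dataset N d) (ℓ : ℝ → ℝ) (η : ℝ) (B : ℕ) (batch : ℕ → Finset (Fin N))
    (w0 : EuclideanSpace ℝ (Fin d)) : ℕ → EuclideanSpace ℝ (Fin d)
  | 0 => w0
  | t + 1 => sgd X ℓ η B batch w0 t -
      (η / B) • ∑ n ∈ batch t, deriv ℓ (inner ℝ (sgd X ℓ η B batch w0 t) (X n)) • X n

/-- Random sampling with replacement: independently at each iteration a random set of `B` distinct
indices is drawn, and every sample has the same probability to be selected. -/
structure SamplingWithReplacement {Ω : Type*} [MeasurableSpace Ω] (μ : Measure Ω) (B : ℕ)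
    (batch : ℕ → Ω → Finset (Fin N)) : Prop where
  measurable : ∀ t, Measurable[_, ⊤] (batch t)
  indep : iIndepFun (m := fun _ => ⊤) batch μ
  card_eq : ∀ t ω, (batch t ω).card = B
  uniform : ∀ t n m, μ {ω | n ∈ batch t ω} = μ {ω | m ∈ batch t ω}

/-- Sampling without replacement: at each epoch, the `K` minibatches of size `B` cover (hence,
when `B * K = N`, partition) the data. -/
structure SamplingWithoutReplacement (B K : ℕ) (batch : ℕ → Finset (Fin N)) : Prop where
  card_eq : ∀ t, (batch t).card = B
  cover : ∀ u : ℕ, ∀ n : Fin N, ∃ k < K, n ∈ batch (K * u + k)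

/-- Learning-rate condition for sampling with replacement. Note that `β σ_max²` is the smoothness
constant of the empirical loss. -/
def StepSizeWith (X : Dataset N d) (β : ℝ≥0) (η : ℝ) (B : ℕ) : Prop :=
  η / B < 2 * margin X ^ 2 / ((β * sigmaMax X ^ 2) * sigmaMax X ^ 2)

/-- Learning-rate condition for sampling without replacement. -/
def StepSizeWithout (X : Dataset N d) (β : ℝ≥0) (η : ℝ) (B K : ℕ) : Prop :=
  η / B < min (1 / (2 * K * β * sigmaMax X ^ 2))
    (margin X / (2 * β * sigmaMax X ^ 3 * (K + (margin X)⁻¹ * sigmaMax X)))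

/-- Case 1: SGD with random sampling with replacement and an admissible learning rate. -/
def CaseWith {Ω : Type*} [MeasurableSpace Ω] (μ : Measure Ω) (X : Dataset N d) (β : ℝ≥0) (η : ℝ)
    (B K : ℕ) (batch : ℕ → Ω → Finset (Fin N)) : Prop :=
  0 < η ∧ B * K = N ∧ StepSizeWith X β η B ∧ SamplingWithReplacement μ B batch

/-- Case 2: SGD with sampling without replacement and an admissible learning rate. -/
def CaseWithout (X : Dataset N d) (β : ℝ≥0) (η : ℝ) (B K : ℕ)
    (batch : ℕ → Finset (Fin N)) : Prop :=
  0 < η ∧ B * K = N ∧ StepSizeWithout X β η B K ∧ SamplingWithoutReplacement B K batch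

/-- `what` solves `argmin ‖w‖²` subject to `wᵀ x_n ≥ 1` for all `n`. -/
def IsMaxMarginSeparator (X : Dataset N d) (what : EuclideanSpace ℝ (Fin d)) : Prop :=
  (∀ n, 1 ≤ inner ℝ what (X n)) ∧
    ∀ w : EuclideanSpace ℝ (Fin d), (∀ n, 1 ≤ inner ℝ w (X n)) → ‖what‖ ^ 2 ≤ ‖w‖ ^ 2

/-- The indices of the support vectors. -/
def supportIdx (X : Dataset N d) (what : EuclideanSpace ℝ (Fin d)) : Set (Fin N) :=
  {n | inner ℝ what (X n) = 1}

/-- The subspace spanned by the support vectors. -/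
def supportSpan (X : Dataset N d) (what : EuclideanSpace ℝ (Fin d)) :
    Submodule ℝ (EuclideanSpace ℝ (Fin d)) :=
  Submodule.span ℝ (X '' supportIdx X what)

/-- `α` are the SVM dual variables (multipliers) of `what`: nonnegative, supported on the support
vectors, with `what = ∑ α_n x_n`. -/
def IsSVMDual (X : Dataset N d) (what : EuclideanSpace ℝ (Fin d)) (α : Fin N → ℝ) : Prop :=
  (∀ n, 0 ≤ α n) ∧ (∀ n, n ∉ supportIdx X what → α n = 0) ∧ what = ∑ n, α n • X n

/-- The support vectors span the data: `rank X_S = rank X`. -/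
def SupportVectorsSpan (X : Dataset N d) (what : EuclideanSpace ℝ (Fin d)) : Prop :=
  Set.finrank ℝ (X '' supportIdx X what) = Set.finrank ℝ (Set.range X)

/-- The equations for `wtilde`: `exp (-x_nᵀ wtilde) = α_n` on the support vectors and
`(I - P) (wtilde - w0) = 0`, with `P` the orthogonal projection onto the span of the support
vectors. -/
def IsResidualLimit (X : Dataset N d) (what : EuclideanSpace ℝ (Fin d)) (α : Fin N → ℝ)
    (w0 wtilde : EuclideanSpace ℝ (Fin d)) : Prop :=
  (∀ n ∈ supportIdx X what, Real.exp (-inner ℝ (X n) wtilde) = α n) ∧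
    (wtilde - w0) - (supportSpan X what).starProjection (wtilde - w0) = 0

/-- `w(t) = what log((η/B) t/K) + wtilde + o(1)`. -/
def HasLogAsymptotics (w : ℕ → EuclideanSpace ℝ (Fin d)) (what wtilde : EuclideanSpace ℝ (Fin d))
    (η : ℝ) (B K : ℕ) : Prop :=
  Tendsto (fun t : ℕ => w t - (Real.log ((η / B) * (t / K)) • what + wtilde)) atTop (𝓝 0)

/-- Two runs with `K₁` and `K₂` minibatches per epoch agree asymptotically when time is measured in
epochs `τ`, i.e. they differ by the linear rescaling of time `t₁ / K₁ = t₂ / K₂` and by `o(1)`. -/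
def AgreePerEpoch (w₁ w₂ : ℕ → EuclideanSpace ℝ (Fin d)) (K₁ K₂ : ℕ) : Prop :=
  Tendsto (fun τ : ℝ => w₁ ⌊K₁ * τ⌋₊ - w₂ ⌊K₂ * τ⌋₊) atTop (𝓝 0)

end MinibatchSGD

end

/-! Put `h = η / B`. Both sampling regimes reduce to one recursion `v(t+1) = v(t) + h ∑ p_n(t) x_n`
(with `h / K` for `h` when sampling with replacement), where `p_n(t) exp(v(t)ᵀ x_n) → 1` and the
`p_n` are square-summable. `log_asymptotics` solves it. Let `r` be the deviation of `v` from `log(h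
t) what + wtilde` and `z_n = rᵀ x_n`. Since `what = ∑ α_n x_n` and `exp(-x_nᵀ wtilde) = α_n` on the
support, the first-order change of `‖r‖²` is about `(2/t) ∑ α_n z_n (exp(-z_n) - 1) ≤ 0`, while the
second-order change is summable. As the support vectors span the data, `r` stays in their span, so a
large `r` makes some `z_n` large and the drift is at most `-c/t`. The harmonic series diverges,
hence `r → 0`.

Without replacement, `v` is the iterate at the ends of epochs. The iterates move little within an
epoch, so the loss decreases by a multiple of the squared gradient (`epoch_bounds`), and summing
over epochs gives square-summability. With replacement the same decrease holds in expectation. The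
centred noise is then an `L²`-bounded martingale, which converges almost surely, and adding its
remaining tail to the iterate gives an exact noiseless recursion (`hasLogAsymptotics_of_noise`).

The nondegeneracy that this needs is generic. The point of the convex hull of the data nearest to
the origin is, by Carathéodory, a positive combination of linearly independent samples, and these
determine `what`. By Fubini, almost surely no other sample lies on the hyperplane `whatᵀ x = 1`, so
these samples are all the support vectors. -/

namespace MinibatchSGD

/-! ### Scalar drift estimates. -/

/-- While `a ≥ R`, the drift is at most `-c/(t+1)`, whose sum diverges, so `a` falls below `R` at
some late time. From below `R` one step adds at most `R` plus an error, and from above `R` only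
errors are added. Hence `a ≤ 2R` plus a tail of `∑ s`, which is at most `3R`. -/
theorem tendsto_zero_of_drift {a b s : ℕ → ℝ} (ha : ∀ t, 0 ≤ a t) (hs0 : ∀ t, 0 ≤ s t)
    (hs : Summable s) (hstep : ∀ t, a (t + 1) ≤ a t + b t / (t + 1) + s t)
    (hsmall : ∀ R > 0, ∀ᶠ t in atTop, b t ≤ R)
    (hneg : ∀ R > 0, ∃ c > 0, ∀ᶠ t in atTop, R ≤ a t → b t ≤ -c) :
    Tendsto a atTop (𝓝 0) := by
  have key : ∀ R > 0, ∀ᶠ t in atTop, a t ≤ 3 * R := by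
    intro R hR
    obtain ⟨c, hc, hneg'⟩ := hneg R hR
    have htail : ∀ᶠ T in atTop, ∀ t, ∑ i ∈ Finset.Ico T t, s i ≤ R := by
      have h1 := tendsto_sum_nat_add s
      filter_upwards [h1.eventually (gt_mem_nhds hR)] with T hT t
      rw [Finset.sum_Ico_eq_sum_range]
      have h2 : Summable fun k => s (k + T) := (summable_nat_add_iff T).2 hs
      have h3 := h2.sum_le_tsum (Finset.range (t - T)) (fun i _ => hs0 _)
      have : ∑ k ∈ Finset.range (t - T), s (T + k) = ∑ k ∈ Finset.range (t - T), s (k + T) :=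
        Finset.sum_congr rfl fun k _ => by rw [add_comm]
      linarith
    obtain ⟨T₀, hT₀⟩ := eventually_atTop.1 ((hneg'.and (hsmall R hR)).and htail)
    have hexit : ∃ T ≥ T₀, a T < R := by
      by_contra! hcon
      have hbd : ∀ k, a (T₀ + k) ≤ a T₀ + ∑ i ∈ Finset.Ico T₀ (T₀ + k), s i
          - c * ∑ i ∈ Finset.range k, 1 / (((i + T₀ : ℕ) : ℝ) + 1) := by
        intro k
        induction k with
        | zero => simp
        | succ k ih =>
          have h1 := hstep (T₀ + k)
          have h2 := (hT₀ (T₀ + k) (by omega)).1.1 (hcon _ (by omega))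
          have h3 : b (T₀ + k) / (((T₀ + k : ℕ) : ℝ) + 1) ≤ -c / (((T₀ + k : ℕ) : ℝ) + 1) := by
            gcongr
          rw [← add_assoc, Finset.sum_Ico_succ_top (by omega), Finset.sum_range_succ, mul_add,
            add_comm k T₀]
          have h4 : -c / (((T₀ + k : ℕ) : ℝ) + 1) = - (c * (1 / (((T₀ + k : ℕ) : ℝ) + 1))) := by
            ring
          linarith
      have hdiv : Tendsto (fun k => ∑ i ∈ Finset.range k, 1 / (((i + T₀ : ℕ) : ℝ) + 1))
          atTop atTop := by
        rw [← not_summable_iff_tendsto_nat_atTop_of_nonneg (fun i => by positivity)]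
        intro hsum
        have h1 := (summable_nat_add_iff (f := fun i : ℕ => 1 / ((i : ℝ) + 1)) T₀).1 hsum
        have h2 := (summable_nat_add_iff (f := fun i : ℕ => 1 / (i : ℝ)) 1).1
          (by simpa using h1)
        exact Real.not_summable_one_div_natCast h2
      obtain ⟨k, hk⟩ := (hdiv.eventually (eventually_gt_atTop ((a T₀ + R) / c))).exists
      have h1 := hbd k
      have h2 := (hT₀ T₀ le_rfl).2 (T₀ + k)
      rw [div_lt_iff₀ hc] at hk
      have := ha (T₀ + k)
      linarith
    obtain ⟨T, hT, haT⟩ := hexit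
    filter_upwards [eventually_ge_atTop T] with t ht
    have hbd : ∀ k, a (T + k) ≤ 2 * R + ∑ i ∈ Finset.Ico T (T + k), s i := by
      intro k
      induction k with
      | zero => simp; linarith
      | succ k ih =>
        have h1 := hstep (T + k)
        have h2 := (hT₀ (T + k) (by omega)).1
        rw [← add_assoc, Finset.sum_Ico_succ_top (by omega)]
        have hpos : (0 : ℝ) < ((T + k : ℕ) : ℝ) + 1 := by positivity
        have hs' : 0 ≤ ∑ i ∈ Finset.Ico T (T + k), s i := Finset.sum_nonneg fun i _ => hs0 i
        rcases le_or_gt R (a (T + k)) with h | h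
        · have h3 : b (T + k) / (((T + k : ℕ) : ℝ) + 1) ≤ 0 :=
            div_nonpos_of_nonpos_of_nonneg (by linarith [h2.1 h]) hpos.le
          linarith
        · have h3 : b (T + k) / (((T + k : ℕ) : ℝ) + 1) ≤ R := by
            rw [div_le_iff₀ hpos]
            have : (0 : ℝ) ≤ ((T + k : ℕ) : ℝ) := by positivity
            nlinarith [h2.2]
          linarith
    have h1 := hbd (t - T)
    rw [Nat.add_sub_cancel' ht] at h1
    have h2 := (hT₀ T hT).2 t
    linarith
  rw [Metric.tendsto_atTop]
  intro ε hε
  obtain ⟨T, hT⟩ := eventually_atTop.1 (key (ε / 6) (by positivity))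
  refine ⟨T, fun t ht => ?_⟩
  rw [Real.dist_0_eq_abs, abs_of_nonneg (ha t)]
  linarith [hT t ht]

/-- The expression is `z` times `y exp(-z) - κ α`, and this factor is antitone in `z`. Its values at
`±ρ`, with limits `α (exp(∓ρ) - 1)` of strict sign, therefore control all `|z| ≥ ρ` uniformly. -/
theorem eventually_exp_drift_le_neg {α : ℝ} (hα : 0 < α) {y κ : ℕ → ℝ}
    (hy : Tendsto y atTop (𝓝 α)) (hκ : Tendsto κ atTop (𝓝 1)) {ρ : ℝ} (hρ : 0 < ρ) :
    ∃ c > 0, ∀ᶠ t in atTop, ∀ z : ℝ, ρ ≤ |z| → y t * (z * Real.exp (-z)) - κ t * α * z ≤ -c := by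
  have h1 : Tendsto (fun t => y t * Real.exp (-ρ) - κ t * α) atTop
      (𝓝 (α * Real.exp (-ρ) - 1 * α)) := (hy.mul_const _).sub (hκ.mul_const _)
  have h2 : Tendsto (fun t => y t * Real.exp ρ - κ t * α) atTop
      (𝓝 (α * Real.exp ρ - 1 * α)) := (hy.mul_const _).sub (hκ.mul_const _)
  have e1 : Real.exp (-ρ) < 1 := by simpa using hρ
  have e2 : 1 < Real.exp ρ := by simpa using hρ
  obtain ⟨c₁, hc₁, hc₁'⟩ : ∃ c₁ > 0, α * Real.exp (-ρ) - 1 * α < -c₁ :=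
    ⟨α * (1 - Real.exp (-ρ)) / 2, by have : 0 < 1 - Real.exp (-ρ) := by linarith
                                     positivity, by nlinarith⟩
  obtain ⟨c₂, hc₂, hc₂'⟩ : ∃ c₂ > 0, c₂ < α * Real.exp ρ - 1 * α :=
    ⟨α * (Real.exp ρ - 1) / 2, by have : 0 < Real.exp ρ - 1 := by linarith
                                  positivity, by nlinarith⟩
  refine ⟨ρ * min c₁ c₂, by positivity, ?_⟩
  filter_upwards [h1.eventually (gt_mem_nhds hc₁'), h2.eventually (lt_mem_nhds hc₂'),
    hy.eventually (lt_mem_nhds hα)] with t ht1 ht2 ht3 z hz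
  have m1 : min c₁ c₂ ≤ c₁ := min_le_left _ _
  have m2 : min c₁ c₂ ≤ c₂ := min_le_right _ _
  have m0 : 0 < min c₁ c₂ := by positivity
  have e : y t * (z * Real.exp (-z)) - κ t * α * z = z * (y t * Real.exp (-z) - κ t * α) := by ring
  rw [e]
  rcases le_total 0 z with h0 | h0
  · rw [abs_of_nonneg h0] at hz
    have : y t * Real.exp (-z) ≤ y t * Real.exp (-ρ) := by gcongr
    have h3 : y t * Real.exp (-z) - κ t * α ≤ - min c₁ c₂ := by linarith
    nlinarith
  · rw [abs_of_nonpos h0] at hz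
    have : y t * Real.exp ρ ≤ y t * Real.exp (-z) := by gcongr
    have h3 : min c₁ c₂ ≤ y t * Real.exp (-z) - κ t * α := by linarith
    nlinarith

theorem mul_exp_neg_le_one (z : ℝ) : z * Real.exp (-z) ≤ 1 := by
  have h := Real.add_one_le_exp z
  rw [Real.exp_neg, ← div_eq_mul_inv, div_le_one (Real.exp_pos z)]
  linarith

theorem eventually_exp_drift_le {α : ℝ} (hα : 0 ≤ α) {y κ : ℕ → ℝ}
    (hy : Tendsto y atTop (𝓝 α)) (hy0 : ∀ t, 0 ≤ y t) (hκ : Tendsto κ atTop (𝓝 1))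
    {R : ℝ} (hR : 0 < R) :
    ∀ᶠ t in atTop, ∀ z : ℝ, y t * (z * Real.exp (-z)) - κ t * α * z ≤ R := by
  rcases hα.eq_or_lt with rfl | hα
  · filter_upwards [hy.eventually (gt_mem_nhds hR)] with t ht z
    have := mul_le_mul_of_nonneg_left (mul_exp_neg_le_one z) (hy0 t)
    linarith
  · set D : ℝ := 2 * α * Real.exp 1 + 2 * α with hD
    have hDpos : 0 < D := by positivity
    -- For `|z| ≤ 1` the two terms together are at most `D |z|`, once `y ≤ 2α` and `κ ≤ 2`. For `|z|
    -- ≥ ρ` the expression is negative.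
    set ρ : ℝ := min 1 (R / D) with hρdef
    have hρ : 0 < ρ := by positivity
    obtain ⟨c, hc, hev⟩ := eventually_exp_drift_le_neg hα hy hκ hρ
    filter_upwards [hev, hy.eventually (gt_mem_nhds (show α < 2 * α by linarith)),
      hκ.eventually (gt_mem_nhds (show (1 : ℝ) < 2 by norm_num)),
      hκ.eventually (lt_mem_nhds (show (0 : ℝ) < 1 by norm_num))] with t ht1 ht2 ht3 ht4 z
    rcases le_or_gt ρ |z| with h | h
    · linarith [ht1 z h]
    · have hz1 : |z| ≤ 1 := h.le.trans (min_le_left _ _)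
      have hz2 : |z| ≤ R / D := h.le.trans (min_le_right _ _)
      have h1 : y t * (z * Real.exp (-z)) ≤ 2 * α * (|z| * Real.exp 1) := by
        have : z * Real.exp (-z) ≤ |z| * Real.exp 1 := by
          gcongr
          · exact le_abs_self z
          · linarith [neg_abs_le z]
        calc _ ≤ y t * (|z| * Real.exp 1) := by gcongr; exact hy0 t
          _ ≤ _ := by gcongr
      have h2 : -(κ t * α * z) ≤ 2 * α * |z| := by
        have : -z ≤ |z| := neg_le_abs z
        calc -(κ t * α * z) = κ t * α * (-z) := by ring
          _ ≤ κ t * α * |z| := by gcongr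
          _ ≤ _ := by gcongr
      have h3 : |z| * D ≤ R := by rwa [le_div_iff₀ hDpos] at hz2
      have : |z| * D = 2 * α * (|z| * Real.exp 1) + 2 * α * |z| := by rw [hD]; ring
      linarith

/-! ### The deterministic recursion and its logarithmic asymptotics. -/

variable {N d : ℕ}

theorem mem_supportSpan (X : Dataset N d) (what : EuclideanSpace ℝ (Fin d)) {n : Fin N}
    (hn : n ∈ supportIdx X what) : X n ∈ supportSpan X what :=
  Submodule.subset_span ⟨n, hn, rfl⟩

theorem eq_zero_of_mem_supportSpan {X : Dataset N d} {what r : EuclideanSpace ℝ (Fin d)}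
    (hr : r ∈ supportSpan X what) (h : ∀ n ∈ supportIdx X what, inner ℝ r (X n) = 0) : r = 0 := by
  have h2 : r ∈ (supportSpan X what)ᗮ := by
    rw [Submodule.mem_orthogonal']
    intro u hu
    induction hu using Submodule.span_induction with
    | mem x hx => obtain ⟨n, hn, rfl⟩ := hx; exact h n hn
    | zero => simp
    | add x y _ _ hx hy => rw [inner_add_right, hx, hy, add_zero]
    | smul c x _ hx => rw [inner_smul_right, hx, mul_zero]
  have := (Submodule.mem_orthogonal' _ _).1 h2 r hr
  exact inner_self_eq_zero.1 this

/-- A vector of the span of the support vectors that is not small has an inner product with some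
support vector that is not small. -/
theorem exists_le_abs_inner (X : Dataset N d) (what : EuclideanSpace ℝ (Fin d)) {R : ℝ}
    (hR : 0 < R) :
    ∃ ρ > 0, ∀ r ∈ supportSpan X what, R ≤ ‖r‖ →
      ∃ n ∈ supportIdx X what, ρ ≤ |inner ℝ r (X n)| := by
  classical
  let T : supportSpan X what →ₗ[ℝ] (supportIdx X what → ℝ) :=
    { toFun := fun r n => inner ℝ (r : EuclideanSpace ℝ (Fin d)) (X n)
      map_add' := fun x y => by ext n; simp [inner_add_left]
      map_smul' := fun c x => by ext n; simp [inner_smul_left] }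
  have hT : LinearMap.ker T = ⊥ := by
    rw [LinearMap.ker_eq_bot']
    intro r hr
    exact Subtype.ext (eq_zero_of_mem_supportSpan r.2 fun n hn => congrFun hr ⟨n, hn⟩)
  -- An injective linear map on a finite-dimensional space is bounded below.
  obtain ⟨K, hK, hT'⟩ := T.exists_antilipschitzWith hT
  refine ⟨R / K, by positivity, fun r hr hRr => ?_⟩
  by_contra! hcon
  have hK' : (0 : ℝ) < K := hK
  have h1 : ‖T ⟨r, hr⟩‖ < R / K := by
    rw [pi_norm_lt_iff (by positivity)]
    intro n
    rw [Real.norm_eq_abs]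
    exact hcon n n.2
  have h2 : ‖r‖ ≤ K * ‖T ⟨r, hr⟩‖ := by
    simpa using hT'.le_mul_dist ⟨r, hr⟩ 0
  rw [lt_div_iff₀ hK'] at h1
  linarith

theorem norm_sum_smul_sq_le (X : Dataset N d) (c : Fin N → ℝ) :
    ‖∑ n, c n • X n‖ ^ 2 ≤ N * ∑ n, c n ^ 2 * ‖X n‖ ^ 2 := by
  have h1 : ‖∑ n, c n • X n‖ ≤ ∑ n, ‖c n • X n‖ := norm_sum_le _ _
  calc _ ≤ (∑ n, ‖c n • X n‖) ^ 2 := by gcongr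
    _ ≤ (Finset.univ : Finset (Fin N)).card * ∑ n, ‖c n • X n‖ ^ 2 := sq_sum_le_card_mul_sum_sq
    _ = _ := by simp [norm_smul, mul_pow]

/-- The deterministic recursion `v(t+1) = v(t) + h ∑ p_n(t) x_n`, with square-summable
`p_n(t) ~ exp(-v(t)ᵀ x_n)`, diverges logarithmically in the direction of the max-margin
separator. -/
theorem log_asymptotics {X : Dataset N d} {what wtilde : EuclideanSpace ℝ (Fin d)} {α : Fin N → ℝ}
    (hone : ∀ n, 1 ≤ inner ℝ what (X n)) (hdual : IsSVMDual X what α)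
    (hpos : ∀ n ∈ supportIdx X what, 0 < α n)
    (hspan : ∀ n, X n ∈ supportSpan X what)
    (htilde : ∀ n ∈ supportIdx X what, Real.exp (-inner ℝ (X n) wtilde) = α n)
    {h : ℝ} (hh : 0 < h) {v : ℕ → EuclideanSpace ℝ (Fin d)} {p : ℕ → Fin N → ℝ}
    (hv : ∀ t, v (t + 1) = v t + h • ∑ n, p t n • X n)
    (hp0 : ∀ t n, 0 ≤ p t n)
    (hp : ∀ n, Tendsto (fun t => p t n * Real.exp (inner ℝ (v t) (X n))) atTop (𝓝 1))
    (hp2 : ∀ n, Summable fun t => p t n ^ 2)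
    (h0 : v 0 - wtilde ∈ supportSpan X what) :
    Tendsto (fun t : ℕ => v t - (Real.log (h * t) • what + wtilde)) atTop (𝓝 0) := by
  obtain ⟨hα0, hαS, hwhat⟩ := hdual
  have hwhat_mem : what ∈ supportSpan X what := by
    have : ∑ n, α n • X n ∈ supportSpan X what :=
      Submodule.sum_mem _ fun n _ => Submodule.smul_mem _ _ (hspan n)
    rwa [← hwhat] at this
  have hvmem : ∀ t, v t - wtilde ∈ supportSpan X what := by
    intro t
    induction t with
    | zero => exact h0
    | succ t ih =>
      rw [hv, add_sub_right_comm]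
      exact Submodule.add_mem _ ih (Submodule.smul_mem _ _
        (Submodule.sum_mem _ fun n _ => Submodule.smul_mem _ _ (hspan n)))
  -- Time is shifted by one to keep the argument of the logarithm positive.
  let l : ℕ → ℝ := fun t => Real.log (h * (t + 1))
  let r : ℕ → EuclideanSpace ℝ (Fin d) := fun t => v (t + 1) - (l t • what + wtilde)
  have hrmem : ∀ t, r t ∈ supportSpan X what := fun t => by
    have : r t = (v (t + 1) - wtilde) - l t • what := by simp only [r]; abel
    rw [this]
    exact Submodule.sub_mem _ (hvmem _) (Submodule.smul_mem _ _ hwhat_mem)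
  suffices hr : Tendsto (fun t => ‖r t‖ ^ 2) atTop (𝓝 0) by
    rw [← tendsto_add_atTop_iff_nat 1, tendsto_zero_iff_norm_tendsto_zero]
    have := hr.sqrt
    simpa [r, l, Real.sqrt_sq] using this
  let z : Fin N → ℕ → ℝ := fun n t => inner ℝ (r t) (X n)
  let y : Fin N → ℕ → ℝ := fun n t => h * (t + 1) * p (t + 1) n * Real.exp (z n t)
  let δ : ℕ → ℝ := fun t => l (t + 1) - l t
  let κ : ℕ → ℝ := fun t => (t + 1) * δ t
  have hδ : ∀ t, δ t = Real.log (1 + 1 / ((t : ℝ) + 1)) := by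
    intro t
    have : (0 : ℝ) < (t : ℝ) + 1 := by positivity
    simp only [δ, l]
    rw [← Real.log_div (by positivity) (by positivity)]
    congr 1
    push_cast
    field_simp
  have hκ : Tendsto κ atTop (𝓝 1) := by
    have h1 := (Real.tendsto_mul_log_one_add_div_atTop 1).comp
      (tendsto_atTop_add_const_right _ 1 (tendsto_natCast_atTop_atTop (R := ℝ)))
    refine h1.congr fun t => ?_
    simp [κ, hδ]
  have hl : Tendsto l atTop atTop :=
    Real.tendsto_log_atTop.comp ((tendsto_atTop_add_const_right _ 1
      (tendsto_natCast_atTop_atTop (R := ℝ))).const_mul_atTop hh)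
  -- Up to a factor tending to `1`, `y n t` is `exp(-x_nᵀ wtilde) (h(t+1))^(1 - whatᵀ x_n)`. The
  -- power is `1` on the support and tends to `0` off it.
  have hy : ∀ n, Tendsto (y n) atTop (𝓝 (α n)) := by
    intro n
    have e1 : ∀ t, y n t = (p (t + 1) n * Real.exp (inner ℝ (v (t + 1)) (X n))) *
        Real.exp (l t * (1 - inner ℝ what (X n))) * Real.exp (-inner ℝ (X n) wtilde) := by
      intro t
      have e2 : h * (t + 1) = Real.exp (l t) := (Real.exp_log (by positivity)).symm
      simp only [y]
      rw [e2, mul_assoc (p (t + 1) n), mul_assoc (p (t + 1) n), ← Real.exp_add, ← Real.exp_add,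
        mul_comm (Real.exp (l t)), mul_assoc (p (t + 1) n), ← Real.exp_add]
      congr 2
      simp only [z, r, inner_sub_left, inner_add_left, inner_smul_left]
      rw [real_inner_comm wtilde (X n)]
      simp
      ring
    have hp' := (hp n).comp (tendsto_add_atTop_nat 1)
    by_cases hn : n ∈ supportIdx X what
    · have hn1 : inner ℝ what (X n) = 1 := hn
      have := (hp'.mul_const (Real.exp (l 0 * 0))).mul_const (Real.exp (-inner ℝ (X n) wtilde))
      simp only [mul_zero, Real.exp_zero, mul_one, one_mul, htilde n hn] at this
      refine this.congr fun t => ?_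
      rw [e1, hn1, htilde n hn]
      simp
    · have hn1 : 1 < inner ℝ what (X n) := lt_of_le_of_ne (hone n) (fun h => hn h.symm)
      have h2 : Tendsto (fun t => Real.exp (l t * (1 - inner ℝ what (X n)))) atTop (𝓝 0) :=
        Real.tendsto_exp_atBot.comp (hl.atTop_mul_const_of_neg (by linarith))
      have := (hp'.mul h2).mul_const (Real.exp (-inner ℝ (X n) wtilde))
      rw [hαS n hn]
      simp only [mul_zero, zero_mul] at this
      exact this.congr fun t => (e1 t).symm
  have hy0 : ∀ n t, 0 ≤ y n t := fun n t => by
    have := hp0 (t + 1) n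
    positivity
  let Δ : ℕ → EuclideanSpace ℝ (Fin d) := fun t => h • ∑ n, p (t + 1) n • X n - δ t • what
  have hrstep : ∀ t, r (t + 1) = r t + Δ t := fun t => by
    simp only [r, Δ, δ]
    rw [hv (t + 1), sub_smul]
    abel
  let D : Fin N → ℕ → ℝ := fun n t => y n t * (z n t * Real.exp (-z n t)) - κ t * α n * z n t
  -- Expanding `what` in the dual variables puts the update and the motion of the reference curve in
  -- one sum over samples, whose terms are close to `α z (exp(-z) - 1)`.
  have hinner : ∀ t, inner ℝ (r t) (Δ t) = (∑ n, D n t) / (t + 1) := by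
    intro t
    have ht : (0 : ℝ) < (t : ℝ) + 1 := by positivity
    have h1 : inner ℝ (r t) what = ∑ n, α n * z n t := by
      conv_lhs => rw [hwhat]
      simp [inner_sum, inner_smul_right, z]
    simp only [Δ, inner_sub_right, inner_smul_right, inner_sum, h1]
    rw [eq_div_iff ht.ne', Finset.mul_sum, Finset.mul_sum, ← Finset.sum_sub_distrib,
      Finset.sum_mul]
    refine Finset.sum_congr rfl fun n _ => ?_
    simp only [D, y, κ]
    have e : Real.exp (z n t) * Real.exp (-z n t) = 1 := by rw [← Real.exp_add]; simp
    have e' : h * (t + 1) * p (t + 1) n * Real.exp (z n t) * (z n t * Real.exp (-z n t)) =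
      h * (t + 1) * p (t + 1) n * z n t * (Real.exp (z n t) * Real.exp (-z n t)) := by ring
    rw [e', e]
    simp only [z]
    ring
  have hsum : Summable fun t => ‖Δ t‖ ^ 2 := by
    have hs1 : Summable fun t : ℕ => ∑ n, p (t + 1) n ^ 2 * ‖X n‖ ^ 2 :=
      summable_sum fun n _ => ((summable_nat_add_iff 1).2 (hp2 n)).mul_right _
    have hs2 : Summable fun t : ℕ => 1 / ((t : ℝ) + 1) ^ 2 := by
      have := (summable_nat_add_iff 1).2 (Real.summable_one_div_nat_pow.2 one_lt_two)
      simpa using this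
    refine Summable.of_nonneg_of_le (fun t => by positivity) (fun t => ?_)
      ((hs1.mul_left (2 * h ^ 2 * N)).add (hs2.mul_left (2 * ‖what‖ ^ 2)))
    have ht : (0 : ℝ) < (t : ℝ) + 1 := by positivity
    have h1 : ‖Δ t‖ ≤ h * ‖∑ n, p (t + 1) n • X n‖ + |δ t| * ‖what‖ := by
      refine (norm_sub_le _ _).trans_eq ?_
      rw [norm_smul, norm_smul, Real.norm_eq_abs, Real.norm_eq_abs, abs_of_pos hh]
    have h2 := norm_sum_smul_sq_le X (p (t + 1))
    have h3 : |δ t| ≤ 1 / ((t : ℝ) + 1) := by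
      rw [hδ, abs_of_nonneg (Real.log_nonneg (by simp; positivity))]
      have := Real.log_le_sub_one_of_pos (show 0 < 1 + 1 / ((t : ℝ) + 1) by positivity)
      linarith
    have h4 : (|δ t| * ‖what‖) ^ 2 ≤ (1 / ((t : ℝ) + 1) * ‖what‖) ^ 2 := by gcongr
    calc ‖Δ t‖ ^ 2 ≤ (h * ‖∑ n, p (t + 1) n • X n‖ + |δ t| * ‖what‖) ^ 2 := by gcongr
      _ ≤ 2 * (h * ‖∑ n, p (t + 1) n • X n‖) ^ 2 + 2 * (|δ t| * ‖what‖) ^ 2 := by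
        nlinarith [sq_nonneg (h * ‖∑ n, p (t + 1) n • X n‖ - |δ t| * ‖what‖)]
      _ ≤ 2 * h ^ 2 * (N * ∑ n, p (t + 1) n ^ 2 * ‖X n‖ ^ 2) +
          2 * (1 / ((t : ℝ) + 1) * ‖what‖) ^ 2 := by
        rw [mul_pow, ← mul_assoc]; gcongr
      _ = _ := by rw [mul_pow (1 / ((t : ℝ) + 1)), div_pow, one_pow]; ring
  refine tendsto_zero_of_drift (b := fun t => 2 * ∑ n, D n t) (s := fun t => ‖Δ t‖ ^ 2)
    (fun t => by positivity) (fun t => by positivity) hsum ?_ ?_ ?_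
  · intro t
    rw [hrstep, norm_add_sq_real, hinner]
    exact le_of_eq (by ring)
  · intro R hR
    have h1 : ∀ n, ∀ᶠ t in atTop, D n t ≤ R / (2 * (N + 1)) := fun n =>
      (eventually_exp_drift_le (hα0 n) (hy n) (hy0 n) hκ (by positivity)).mono fun t ht => ht _
    filter_upwards [eventually_all.2 h1] with t ht
    have h2 : ∑ n, D n t ≤ N * (R / (2 * (N + 1))) := by
      simpa using Finset.sum_le_card_nsmul Finset.univ (fun n => D n t) _ (fun n _ => ht n)
    have h3 : N * (R / (2 * ((N : ℝ) + 1))) ≤ R / 2 := by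
      rw [mul_div_assoc', div_le_div_iff₀ (by positivity) (by positivity)]
      nlinarith
    linarith
  · intro R hR
    obtain ⟨ρ, hρ, hex⟩ := exists_le_abs_inner X what (Real.sqrt_pos.2 hR)
    have hc : ∀ n, ∃ c > 0, n ∈ supportIdx X what →
        ∀ᶠ t in atTop, ρ ≤ |z n t| → D n t ≤ -c := by
      intro n
      by_cases hn : n ∈ supportIdx X what
      · obtain ⟨c, hc, hev⟩ := eventually_exp_drift_le_neg (hpos n hn) (hy n) hκ hρ
        exact ⟨c, hc, fun _ => hev.mono fun t ht => ht _⟩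
      · exact ⟨1, one_pos, fun h => absurd h hn⟩
    choose c hc hc' using hc
    obtain ⟨c₀, hc₀, hc₀'⟩ : ∃ c₀ > 0, ∀ n, c₀ ≤ c n := by
      -- The extra element `none` makes the minimum exist also for `N = 0`.
      have := Finite.exists_min (fun o : Option (Fin N) => o.elim 1 c)
      obtain ⟨o, ho⟩ := this
      refine ⟨o.elim 1 c, ?_, fun n => ho (some n)⟩
      cases o with
      | none => exact one_pos
      | some n => exact hc n
    refine ⟨c₀, hc₀, ?_⟩
    -- The constant lets all the other samples together undo at most half of the decrease `c₀` due
    -- to the sample `m` below.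
    have h1 : ∀ n, ∀ᶠ t in atTop, D n t ≤ c₀ / (2 * (N + 1)) := fun n =>
      (eventually_exp_drift_le (hα0 n) (hy n) (hy0 n) hκ (by positivity)).mono fun t ht => ht _
    have h2 : ∀ n, ∀ᶠ t in atTop, n ∈ supportIdx X what → ρ ≤ |z n t| → D n t ≤ -c n := by
      intro n
      by_cases hn : n ∈ supportIdx X what
      · exact (hc' n hn).mono fun t ht _ => ht
      · exact Eventually.of_forall fun t h => absurd h hn
    filter_upwards [eventually_all.2 h1, eventually_all.2 h2] with t ht1 ht2 hRt
    obtain ⟨m, hm, hρm⟩ := hex (r t) (hrmem t) (Real.sqrt_le_iff.2 ⟨norm_nonneg _, hRt⟩)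
    have h3 := ht2 m hm hρm
    rw [← Finset.add_sum_erase _ _ (Finset.mem_univ m)]
    have h4 : ∑ n ∈ Finset.univ.erase m, D n t ≤ N * (c₀ / (2 * (N + 1))) := by
      refine (Finset.sum_le_card_nsmul _ (fun n => D n t) _ (fun n _ => ht1 n)).trans ?_
      rw [nsmul_eq_mul]
      gcongr
      simp
    have h5 : N * (c₀ / (2 * ((N : ℝ) + 1))) ≤ c₀ / 2 := by
      rw [mul_div_assoc', div_le_div_iff₀ (by positivity) (by positivity)]
      nlinarith
    have := hc₀' m
    linarith

/-! ### Inequalities for the largest singular value and the margin. -/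

section Data

theorem dataMap_apply (X : Dataset N d) (c : EuclideanSpace ℝ (Fin N)) :
    dataMap X c = ∑ n, c n • X n := by
  simp [dataMap]

theorem norm_sum_smul_le_sigmaMax (X : Dataset N d) (c : EuclideanSpace ℝ (Fin N)) :
    ‖∑ n, c n • X n‖ ≤ sigmaMax X * ‖c‖ := by
  rw [← dataMap_apply]
  exact (dataMap X).le_opNorm c

theorem norm_sum_smul_sq_le_sigmaMax (X : Dataset N d) (c : Fin N → ℝ) :
    ‖∑ n, c n • X n‖ ^ 2 ≤ sigmaMax X ^ 2 * ∑ n, c n ^ 2 := by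
  have h := norm_sum_smul_le_sigmaMax X (WithLp.toLp 2 c)
  have h2 := EuclideanSpace.real_norm_sq_eq (WithLp.toLp 2 c)
  calc _ ≤ (sigmaMax X * ‖WithLp.toLp 2 c‖) ^ 2 := by gcongr
    _ = _ := by rw [mul_pow, h2]

/-- The transpose of the data matrix has the same norm: apply the bound for the matrix to the
coefficients `vᵀ x_n` themselves, use Cauchy–Schwarz and cancel one factor `S`. -/
theorem sum_inner_sq_le (X : Dataset N d) (v : EuclideanSpace ℝ (Fin d)) :
    ∑ n, inner ℝ v (X n) ^ 2 ≤ sigmaMax X ^ 2 * ‖v‖ ^ 2 := by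
  set c : Fin N → ℝ := fun n => inner ℝ v (X n) with hc
  set S := ∑ n, c n ^ 2 with hS
  have hS0 : 0 ≤ S := Finset.sum_nonneg fun n _ => sq_nonneg _
  have h1 : S = inner ℝ v (∑ n, c n • X n) := by
    rw [inner_sum]
    exact Finset.sum_congr rfl fun n _ => by rw [inner_smul_right, sq]
  have h2 : S ≤ ‖v‖ * ‖∑ n, c n • X n‖ := h1 ▸ real_inner_le_norm _ _
  have h3 : S ^ 2 ≤ ‖v‖ ^ 2 * (sigmaMax X ^ 2 * S) := by
    calc S ^ 2 ≤ (‖v‖ * ‖∑ n, c n • X n‖) ^ 2 := by gcongr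
      _ ≤ _ := by rw [mul_pow]; gcongr; exact norm_sum_smul_sq_le_sigmaMax X c
  rcases hS0.eq_or_lt with h | h
  · rw [← h]; positivity
  · have : S * S ≤ (sigmaMax X ^ 2 * ‖v‖ ^ 2) * S := by nlinarith
    exact le_of_mul_le_mul_right this h

theorem norm_le_sigmaMax (X : Dataset N d) (n : Fin N) : ‖X n‖ ≤ sigmaMax X := by
  have h := norm_sum_smul_le_sigmaMax X (EuclideanSpace.single n 1)
  simpa [Pi.single_apply, Finset.sum_ite_eq] using h

theorem margin_bound (X : Dataset N d) (n : Fin N) {m : ℝ}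
    (hm : m ∈ {m : ℝ | ∃ w : EuclideanSpace ℝ (Fin d), ‖w‖ = 1 ∧ m = ⨅ n, inner ℝ w (X n)}) :
    m ≤ ‖X n‖ := by
  obtain ⟨w, hw, rfl⟩ := hm
  calc ⨅ n, inner ℝ w (X n) ≤ inner ℝ w (X n) := ciInf_le (Set.finite_range _).bddBelow n
    _ ≤ ‖w‖ * ‖X n‖ := real_inner_le_norm _ _
    _ = ‖X n‖ := by rw [hw, one_mul]

/-- Normalising a separator gives a positive element of the set. Together with `margin_bound` this
makes the real `sSup` in `margin` a true supremum rather than the default `0`. -/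
theorem exists_margin_pos {X : Dataset N d} (hN : 0 < N) (hX : LinearlySeparable X) :
    ∃ m > 0, m ∈ {m : ℝ | ∃ w : EuclideanSpace ℝ (Fin d), ‖w‖ = 1 ∧
      m = ⨅ n, inner ℝ w (X n)} := by
  obtain ⟨w, hw⟩ := hX
  have : Nonempty (Fin N) := ⟨⟨0, hN⟩⟩
  have hw0 : w ≠ 0 := by
    rintro rfl
    simpa using hw ⟨0, hN⟩
  have hw' : 0 < ‖w‖ := norm_pos_iff.2 hw0
  obtain ⟨n, hn⟩ := exists_eq_ciInf_of_finite (f := fun n => inner ℝ (‖w‖⁻¹ • w) (X n))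
  refine ⟨_, ?_, ‖w‖⁻¹ • w, by simp [norm_smul, hw'.ne'], rfl⟩
  rw [gt_iff_lt, ← hn, inner_smul_left]
  have := hw n
  simp only [map_inv₀, conj_trivial]
  positivity

theorem margin_pos {X : Dataset N d} (hN : 0 < N) (hX : LinearlySeparable X) : 0 < margin X := by
  obtain ⟨m, hm, hmem⟩ := exists_margin_pos hN hX
  exact hm.trans_le (le_csSup ⟨_, fun _ h => margin_bound X ⟨0, hN⟩ h⟩ hmem)

theorem margin_le_sigmaMax {X : Dataset N d} (hN : 0 < N) (hX : LinearlySeparable X) :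
    margin X ≤ sigmaMax X := by
  obtain ⟨m, hm, hmem⟩ := exists_margin_pos hN hX
  exact csSup_le ⟨m, hmem⟩ fun _ h =>
    (margin_bound X ⟨0, hN⟩ h).trans (norm_le_sigmaMax X _)

/-- Pair the combination with a unit vector `w`: the result is at least `(min_n wᵀ x_n) ∑ f` and at
most the norm. So nonnegative coefficients cannot cancel, and the full gradient controls every
single derivative. -/
theorem margin_mul_sum_le {X : Dataset N d} (hN : 0 < N) (hX : LinearlySeparable X)
    {f : Fin N → ℝ} (hf : ∀ n, 0 ≤ f n) : margin X * ∑ n, f n ≤ ‖∑ n, f n • X n‖ := by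
  obtain ⟨m, hm, hmem⟩ := exists_margin_pos hN hX
  have hS : 0 ≤ ∑ n, f n := Finset.sum_nonneg fun n _ => hf n
  rcases hS.eq_or_lt with h | h
  · rw [← h]; simp
  rw [← le_div_iff₀ h]
  refine csSup_le ⟨m, hmem⟩ ?_
  rintro _ ⟨w, hw, rfl⟩
  rw [le_div_iff₀ h, Finset.mul_sum]
  calc ∑ n, (⨅ n, inner ℝ w (X n)) * f n ≤ ∑ n, inner ℝ w (X n) * f n := by
        gcongr with n
        · exact hf n
        · exact ciInf_le (Set.finite_range _).bddBelow n
    _ = inner ℝ w (∑ n, f n • X n) := by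
        rw [inner_sum]
        exact Finset.sum_congr rfl fun n _ => by rw [inner_smul_right, mul_comm]
    _ ≤ ‖w‖ * ‖∑ n, f n • X n‖ := real_inner_le_norm _ _
    _ = _ := by rw [hw, one_mul]

theorem margin_sq_mul_sum_sq_le {X : Dataset N d} (hN : 0 < N) (hX : LinearlySeparable X)
    {f : Fin N → ℝ} (hf : ∀ n, 0 ≤ f n) :
    margin X ^ 2 * ∑ n, f n ^ 2 ≤ ‖∑ n, f n • X n‖ ^ 2 := by
  have h1 : ∑ n, f n ^ 2 ≤ (∑ n, f n) ^ 2 := Finset.sum_sq_le_sq_sum_of_nonneg fun n _ => hf n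
  have h2 := margin_mul_sum_le hN hX hf
  have h3 := margin_pos hN hX
  have h4 : 0 ≤ ∑ n, f n := Finset.sum_nonneg fun n _ => hf n
  calc _ ≤ margin X ^ 2 * (∑ n, f n) ^ 2 := by gcongr
    _ = (margin X * ∑ n, f n) ^ 2 := by ring
    _ ≤ _ := by gcongr

end Data

/-! ### Smooth monotone losses and the empirical loss. -/

section Loss

/-- A function with `β`-Lipschitz derivative lies below its quadratic upper models. -/
theorem le_quadratic_of_lipschitz_deriv {ℓ : ℝ → ℝ} {β : ℝ≥0} (hd : Differentiable ℝ ℓ)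
    (hs : LipschitzWith β (deriv ℓ)) (a b : ℝ) :
    ℓ b ≤ ℓ a + deriv ℓ a * (b - a) + β / 2 * (b - a) ^ 2 := by
  let φ : ℝ → ℝ := fun s => ℓ a + deriv ℓ a * (s - a) + β / 2 * (s - a) ^ 2 - ℓ s
  have hφ : ∀ s, HasDerivAt φ (deriv ℓ a + β * (s - a) - deriv ℓ s) s := by
    intro s
    have h1 : HasDerivAt (fun s : ℝ => s - a) 1 s := (hasDerivAt_id s).sub_const a
    have h2 := (((h1.const_mul (deriv ℓ a)).const_add (ℓ a)).add
      ((h1.pow 2).const_mul ((β : ℝ) / 2))).sub (hd s).hasDerivAt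
    refine h2.congr_deriv ?_
    simp
    ring
  have hφc : Continuous φ := continuous_iff_continuousAt.2 fun s => (hφ s).continuousAt
  have hL : ∀ s, |deriv ℓ s - deriv ℓ a| ≤ β * |s - a| := fun s => by
    simpa [Real.dist_eq] using hs.dist_le_mul s a
  have ha : φ a = 0 := by simp [φ]
  suffices 0 ≤ φ b by simp only [φ] at this; linarith
  rw [← ha]
  rcases le_total a b with hab | hab
  · refine monotoneOn_of_deriv_nonneg (convex_Ici a) hφc.continuousOn
      (fun s _ => (hφ s).differentiableAt.differentiableWithinAt) (fun s hs' => ?_)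
      (Set.self_mem_Ici) hab hab
    rw [interior_Ici] at hs'
    rw [(hφ s).deriv]
    have h1 := hL s
    rw [abs_of_pos (show 0 < s - a from sub_pos.2 hs')] at h1
    linarith [le_abs_self (deriv ℓ s - deriv ℓ a)]
  · refine antitoneOn_of_deriv_nonpos (convex_Iic a) hφc.continuousOn
      (fun s _ => (hφ s).differentiableAt.differentiableWithinAt) (fun s hs' => ?_)
      hab (Set.self_mem_Iic) hab
    rw [interior_Iic] at hs'
    rw [(hφ s).deriv]
    have h1 := hL s
    rw [abs_of_neg (show s - a < 0 from sub_neg.2 hs')] at h1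
    linarith [neg_abs_le (deriv ℓ s - deriv ℓ a)]

/-- The empirical loss. -/
noncomputable def empLoss (X : Dataset N d) (ℓ : ℝ → ℝ) (w : EuclideanSpace ℝ (Fin d)) : ℝ :=
  ∑ n, ℓ (inner ℝ w (X n))

/-- The negative gradient of the empirical loss. -/
noncomputable def negGrad (X : Dataset N d) (ℓ : ℝ → ℝ) (w : EuclideanSpace ℝ (Fin d)) :
    EuclideanSpace ℝ (Fin d) :=
  ∑ n, (-deriv ℓ (inner ℝ w (X n))) • X n

/-- The one-dimensional quadratic bounds are summed over the samples, and `sum_inner_sq_le` turns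
the quadratic terms into the smoothness constant `β σ²`. -/
theorem empLoss_add_le {ℓ : ℝ → ℝ} {β : ℝ≥0} (hℓ : IsSmoothMonotoneLoss ℓ β) (X : Dataset N d)
    (w v : EuclideanSpace ℝ (Fin d)) :
    empLoss X ℓ (w + v) ≤ empLoss X ℓ w - inner ℝ (negGrad X ℓ w) v
      + β * sigmaMax X ^ 2 / 2 * ‖v‖ ^ 2 := by
  have h1 : ∀ n, ℓ (inner ℝ (w + v) (X n)) ≤ ℓ (inner ℝ w (X n)) +
      deriv ℓ (inner ℝ w (X n)) * inner ℝ v (X n) + β / 2 * inner ℝ v (X n) ^ 2 := fun n => by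
    have := le_quadratic_of_lipschitz_deriv hℓ.differentiable hℓ.smooth
      (inner ℝ w (X n)) (inner ℝ (w + v) (X n))
    rwa [inner_add_left, add_sub_cancel_left, ← inner_add_left] at this
  have h2 := Finset.sum_le_sum fun n (_ : n ∈ Finset.univ) => h1 n
  have h3 : inner ℝ (negGrad X ℓ w) v = -∑ n, deriv ℓ (inner ℝ w (X n)) * inner ℝ v (X n) := by
    rw [negGrad, sum_inner, ← Finset.sum_neg_distrib]
    refine Finset.sum_congr rfl fun n _ => ?_
    rw [inner_smul_left, real_inner_comm (X n) v]
    simp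
  rw [Finset.sum_add_distrib, Finset.sum_add_distrib, ← Finset.mul_sum] at h2
  have h4 := mul_le_mul_of_nonneg_left (sum_inner_sq_le X v)
    (show (0 : ℝ) ≤ β / 2 by positivity)
  rw [h3]
  unfold empLoss
  linarith

theorem empLoss_nonneg {ℓ : ℝ → ℝ} {β : ℝ≥0} (hℓ : IsSmoothMonotoneLoss ℓ β) (X : Dataset N d)
    (w : EuclideanSpace ℝ (Fin d)) : 0 ≤ empLoss X ℓ w :=
  Finset.sum_nonneg fun _ _ => (hℓ.pos _).le

theorem sum_deriv_sq_le {ℓ : ℝ → ℝ} {β : ℝ≥0} (hℓ : IsSmoothMonotoneLoss ℓ β) {X : Dataset N d}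
    (hN : 0 < N) (hX : LinearlySeparable X) (w : EuclideanSpace ℝ (Fin d)) :
    ∑ n, deriv ℓ (inner ℝ w (X n)) ^ 2 ≤ ‖negGrad X ℓ w‖ ^ 2 / margin X ^ 2 := by
  have h := margin_sq_mul_sum_sq_le hN hX (f := fun n => -deriv ℓ (inner ℝ w (X n)))
    (fun n => by linarith [hℓ.deriv_neg (inner ℝ w (X n))])
  rw [le_div_iff₀ (by have := margin_pos hN hX; positivity), mul_comm]
  simpa [negGrad] using h

/-- On every half-line `(-∞, M]` the derivative is bounded away from zero: near `-∞` by `limsup_ne`,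
and on the remaining compact interval by continuity and negativity. -/
theorem tendsto_atTop_of_deriv_tendsto_zero {ℓ : ℝ → ℝ} {β : ℝ≥0}
    (hℓ : IsSmoothMonotoneLoss ℓ β) {ι : Type*} {F : Filter ι} {u : ι → ℝ}
    (hu : Tendsto (fun i => deriv ℓ (u i)) F (𝓝 0)) : Tendsto u F atTop := by
  obtain ⟨c, hc, A, hA⟩ : ∃ c < 0, ∃ A, ∀ x ≤ A, deriv ℓ x < c := by
    have h1 : limsup (fun u => ((deriv ℓ u : ℝ) : EReal)) atBot < 0 := by
      refine lt_of_le_of_ne ?_ hℓ.limsup_ne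
      refine limsup_le_of_le (h := Eventually.of_forall fun u => ?_)
      exact_mod_cast (hℓ.deriv_neg u).le
    obtain ⟨c, hc1, hc2⟩ := EReal.lt_iff_exists_real_btwn.1 h1
    obtain ⟨A, hA⟩ := eventually_atBot.1 (eventually_lt_of_limsup_lt hc1)
    exact ⟨c, by exact_mod_cast hc2, A, fun x hx => by exact_mod_cast hA x hx⟩
  rw [tendsto_atTop]
  intro M
  obtain ⟨c', hc', hM⟩ : ∃ c' < 0, ∀ x ∈ Set.Icc A M, deriv ℓ x ≤ c' := by
    rcases (Set.Icc A M).eq_empty_or_nonempty with h | h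
    · exact ⟨-1, by norm_num, by simp [h]⟩
    · obtain ⟨x, _, hx⟩ := isCompact_Icc.exists_isMaxOn h hℓ.smooth.continuous.continuousOn
      exact ⟨deriv ℓ x, hℓ.deriv_neg x, fun y hy => hx hy⟩
  filter_upwards [hu.eventually (lt_mem_nhds hc), hu.eventually (lt_mem_nhds hc')] with i h1 h2
  by_contra! hcon
  rcases le_total (u i) A with h | h
  · linarith [hA _ h]
  · linarith [hM _ ⟨h, hcon.le⟩]

theorem HasTightExpTail.tendsto_mul_exp {f : ℝ → ℝ} (hf : HasTightExpTail f) :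
    Tendsto (fun u => f u * Real.exp u) atTop (𝓝 1) := by
  obtain ⟨μp, μm, ubar, hp, hm, -, h⟩ := hf
  have e : ∀ μ > 0, Tendsto (fun u : ℝ => Real.exp (-μ * u)) atTop (𝓝 0) := fun μ hμ =>
    Real.tendsto_exp_atBot.comp (tendsto_id.const_mul_atTop_of_neg (by linarith))
  have e1 : ∀ u : ℝ, Real.exp (-u) * Real.exp u = 1 := fun u => by simp [← Real.exp_add]
  refine tendsto_of_tendsto_of_tendsto_of_le_of_le' (g := fun u => 1 - Real.exp (-μm * u))
    (h := fun u => 1 + Real.exp (-μp * u)) ?_ ?_ ?_ ?_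
  · simpa using tendsto_const_nhds.sub (e μm hm)
  · simpa using tendsto_const_nhds.add (e μp hp)
  · filter_upwards [eventually_gt_atTop ubar] with u hu
    have := mul_le_mul_of_nonneg_right (h u hu).1 (Real.exp_pos u).le
    rwa [mul_assoc, e1, mul_one] at this
  · filter_upwards [eventually_gt_atTop ubar] with u hu
    have := mul_le_mul_of_nonneg_right (h u hu).2 (Real.exp_pos u).le
    rwa [mul_assoc, e1, mul_one] at this

end Loss

/-! ### Sampling without replacement: decrease of the loss over an epoch. -/

theorem tendsto_log_sub_log {ι : Type*} {F : Filter ι} {f g : ι → ℝ}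
    (h : Tendsto (fun i => f i / g i) F (𝓝 1)) :
    Tendsto (fun i => Real.log (f i) - Real.log (g i)) F (𝓝 0) := by
  have h1 := ((Real.continuousAt_log one_ne_zero).tendsto.comp h)
  rw [Real.log_one] at h1
  refine h1.congr' ?_
  filter_upwards [h.eventually_ne one_ne_zero] with i hi
  rw [div_ne_zero_iff] at hi
  exact Real.log_div hi.1 hi.2

/-- By counting: every sample occurs in an epoch at least once and there are `B K = N` occurrences
in all, so each occurs exactly once. -/
theorem SamplingWithoutReplacement.exists_index {B K : ℕ} (hBK : B * K = N)
    {batch : ℕ → Finset (Fin N)} (hs : SamplingWithoutReplacement B K batch) (u : ℕ) :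
    ∃ κ : Fin N → ℕ, (∀ n, κ n < K) ∧ ∀ k < K, ∀ n, n ∈ batch (K * u + k) ↔ κ n = k := by
  classical
  choose κ hκ hmem using hs.cover u
  refine ⟨κ, hκ, ?_⟩
  let S : Fin N → Finset ℕ := fun n => {k ∈ Finset.range K | n ∈ batch (K * u + k)}
  have hone : ∀ n, 1 ≤ (S n).card := fun n =>
    Finset.card_pos.2 ⟨κ n, by simp [S, hκ, hmem]⟩
  have htot : ∑ n, (S n).card = ∑ n : Fin N, 1 := by
    have h1 : ∑ n, (S n).card = ∑ k ∈ Finset.range K, (batch (K * u + k)).card := by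
      simp only [S, Finset.card_filter]
      rw [Finset.sum_comm]
      refine Finset.sum_congr rfl fun k _ => ?_
      rw [← Finset.card_filter]
      simp
    rw [h1]
    simp [hs.card_eq, ← hBK, mul_comm]
  have hcard := (Finset.sum_eq_sum_iff_of_le fun n _ => hone n).1 htot.symm
  intro k hk n
  constructor
  · intro h
    obtain ⟨a, ha⟩ := Finset.card_eq_one.1 (hcard n (Finset.mem_univ n)).symm
    have h1 : k ∈ S n := by simp [S, hk, h]
    have h2 : κ n ∈ S n := by simp [S, hκ, hmem]
    rw [ha, Finset.mem_singleton] at h1 h2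
    rw [h1, h2]
  · rintro rfl
    exact hmem n

/-- The constant of the per-epoch decrease of the loss is positive under the learning-rate
condition of sampling without replacement. -/
theorem epoch_decrease_pos {γ σ β h K : ℝ} (hγ : 0 < γ) (hγσ : γ ≤ σ) (hβ : 0 < β) (hh : 0 < h)
    (hK : 1 ≤ K) (hstep : h < γ / (2 * β * σ ^ 3 * (K + γ⁻¹ * σ))) :
    0 < h * ((1 - 2 * (h * β * σ ^ 2 * K) * σ / γ)
      - β * σ ^ 2 / 2 * h * (1 + 2 * (h * β * σ ^ 2 * K) * σ / γ) ^ 2) := by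
  have hσ : 0 < σ := hγ.trans_le hγσ
  have hK0 : 0 < K := by linarith
  set P := h * β * σ ^ 2 with hP
  have hP0 : 0 < P := by positivity
  rw [lt_div_iff₀ (by positivity)] at hstep
  have h1 : 2 * P * (σ * K + σ ^ 2 * γ⁻¹) < γ := by
    have : h * (2 * β * σ ^ 3 * (K + γ⁻¹ * σ)) = 2 * P * (σ * K + σ ^ 2 * γ⁻¹) := by
      rw [hP]; ring
    linarith
  set ρ := 2 * (P * K) * σ / γ with hρ
  have hρ0 : 0 ≤ ρ := by positivity
  have h2 : 2 * P ≤ 2 * P * σ ^ 2 * γ⁻¹ * γ⁻¹ := by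
    have : 1 ≤ σ * γ⁻¹ := by rw [← div_eq_mul_inv]; exact (one_le_div hγ).2 hγσ
    have h3 : 1 ≤ (σ * γ⁻¹) ^ 2 := one_le_pow₀ this
    calc 2 * P = 2 * P * 1 := by ring
      _ ≤ 2 * P * (σ * γ⁻¹) ^ 2 := by gcongr
      _ = _ := by ring
  -- This is the learning-rate bound divided by `γ`. With `γ ≤ σ` it gives `2P < 1 - ρ`, and `ρ < 1`
  -- bounds the quadratic term by `2P`.
  have h3 : ρ + 2 * P * σ ^ 2 * γ⁻¹ * γ⁻¹ < 1 := by
    have h4 : (2 * P * (σ * K + σ ^ 2 * γ⁻¹)) * γ⁻¹ < γ * γ⁻¹ := by gcongr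
    rw [mul_inv_cancel₀ hγ.ne'] at h4
    have : (2 * P * (σ * K + σ ^ 2 * γ⁻¹)) * γ⁻¹ = ρ + 2 * P * σ ^ 2 * γ⁻¹ * γ⁻¹ := by
      rw [hρ]; ring
    linarith
  have h4 : 2 * P < 1 - ρ := by linarith
  have h5 : β * σ ^ 2 / 2 * h * (1 + ρ) ^ 2 = P * ((1 + ρ) ^ 2 / 2) := by rw [hP]; ring
  have h6 : (1 + ρ) ^ 2 / 2 ≤ 2 := by nlinarith
  rw [h5]
  have : P * ((1 + ρ) ^ 2 / 2) ≤ P * 2 := by gcongr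
  apply mul_pos hh
  linarith

/-- One epoch of SGD sampling without replacement: the coefficients `a n` of the total update,
with `κ n` the iteration at which the sample `n` is used. -/
theorem epoch_bounds {ℓ : ℝ → ℝ} {β : ℝ≥0} (hℓ : IsSmoothMonotoneLoss ℓ β) {X : Dataset N d}
    (hN : 0 < N) (hX : LinearlySeparable X) {h : ℝ} (hh : 0 < h) {K : ℕ} (hK : 0 < K)
    (hβ : 0 < (β : ℝ)) (hstep : h < min (1 / (2 * K * β * sigmaMax X ^ 2))
      (margin X / (2 * β * sigmaMax X ^ 3 * (K + (margin X)⁻¹ * sigmaMax X))))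
    {w : ℕ → EuclideanSpace ℝ (Fin d)} {S : ℕ → Finset (Fin N)} {κ : Fin N → ℕ}
    (hκ : ∀ n, κ n < K) (hS : ∀ k < K, ∀ n, n ∈ S k ↔ κ n = k)
    (hw : ∀ k < K, w (k + 1) = w k - h • ∑ n ∈ S k, deriv ℓ (inner ℝ (w k) (X n)) • X n)
    {a : Fin N → ℝ} (ha : ∀ n, a n = -deriv ℓ (inner ℝ (w (κ n)) (X n))) :
    w K = w 0 + h • ∑ n, a n • X n ∧
    ∑ n, a n ^ 2 ≤ 4 * (‖negGrad X ℓ (w 0)‖ ^ 2 / margin X ^ 2) ∧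
    (∀ k ≤ K, ‖w k - w 0‖ ^ 2 ≤ h ^ 2 * sigmaMax X ^ 2 * ∑ n, a n ^ 2) ∧
    empLoss X ℓ (w K) ≤ empLoss X ℓ (w 0) -
      h * ((1 - 2 * (h * β * sigmaMax X ^ 2 * K) * sigmaMax X / margin X)
        - β * sigmaMax X ^ 2 / 2 * h *
          (1 + 2 * (h * β * sigmaMax X ^ 2 * K) * sigmaMax X / margin X) ^ 2) *
        ‖negGrad X ℓ (w 0)‖ ^ 2 := by
  classical
  have hγ := margin_pos hN hX
  have hγσ := margin_le_sigmaMax hN hX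
  set σ := sigmaMax X
  set γ := margin X
  have hσ : 0 < σ := hγ.trans_le hγσ
  have hK1 : (1 : ℝ) ≤ K := by exact_mod_cast hK
  have hpart : ∀ k ≤ K, w k = w 0 + h • ∑ n, (if κ n < k then a n else 0) • X n := by
    intro k
    induction k with
    | zero => simp
    | succ k ih =>
      intro hk
      have hk' : k < K := hk
      have h1 : S k = Finset.univ.filter fun n => κ n = k := by
        ext n; simp [hS k hk' n]
      have h2 : -(∑ n ∈ S k, deriv ℓ (inner ℝ (w k) (X n)) • X n) =
          ∑ n, (if κ n = k then a n else 0) • X n := by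
        rw [h1, Finset.sum_filter, ← Finset.sum_neg_distrib]
        refine Finset.sum_congr rfl fun n _ => ?_
        split_ifs with h
        · rw [ha, h, neg_smul]
        · simp
      rw [hw k hk', sub_eq_add_neg, ← smul_neg, h2, ih hk'.le, add_assoc, ← smul_add,
        ← Finset.sum_add_distrib]
      congr 2
      refine Finset.sum_congr rfl fun n _ => ?_
      rcases lt_trichotomy (κ n) k with h | h | h
      · simp [h, h.ne, h.trans (Nat.lt_succ_self k)]
      · simp [h]
      · simp [h.not_gt, h.ne', show ¬ κ n < k + 1 by omega]
  have hwK : w K = w 0 + h • ∑ n, a n • X n := by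
    rw [hpart K le_rfl]
    simp [hκ]
  have hdist : ∀ k ≤ K, ‖w k - w 0‖ ^ 2 ≤ h ^ 2 * σ ^ 2 * ∑ n, a n ^ 2 := by
    intro k hk
    rw [hpart k hk, add_sub_cancel_left, norm_smul, mul_pow, Real.norm_eq_abs, sq_abs, mul_assoc]
    gcongr
    refine (norm_sum_smul_sq_le_sigmaMax X _).trans ?_
    refine mul_le_mul_of_nonneg_left (Finset.sum_le_sum fun n _ => ?_) (sq_nonneg _)
    split_ifs
    · exact le_rfl
    · simp [sq_nonneg]
  -- `q` bounds the relative change of the derivatives during the epoch. The first bound in the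
  -- minimum says `q < 1/2`.
  set q := h * β * σ ^ 2 * K with hq
  have hq0 : 0 ≤ q := by positivity
  have hq2 : q < 1 / 2 := by
    have h1 := hstep.trans_le (min_le_left _ _)
    rw [lt_div_iff₀ (by positivity)] at h1
    rw [hq]
    linarith
  set f : Fin N → ℝ := fun n => -deriv ℓ (inner ℝ (w 0) (X n)) with hf
  have herr : ∑ n, (a n - f n) ^ 2 ≤ q ^ 2 * ∑ n, a n ^ 2 := by
    -- The single iterate `κ n` is replaced by the sum over the whole epoch, so that the sums can be
    -- exchanged and `sum_inner_sq_le` applied at each iterate. The cost is a factor `K`, enlarged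
    -- to `K²` to form `q²`.
    have h1 : ∀ n, (a n - f n) ^ 2 ≤
        ∑ k ∈ Finset.range K, β ^ 2 * inner ℝ (w k - w 0) (X n) ^ 2 := by
      intro n
      have h2 : |a n - f n| ≤ β * |inner ℝ (w (κ n) - w 0) (X n)| := by
        have := hℓ.smooth.dist_le_mul (inner ℝ (w (κ n)) (X n)) (inner ℝ (w 0) (X n))
        rw [Real.dist_eq, Real.dist_eq, ← inner_sub_left] at this
        rw [ha, hf, ← abs_neg]
        convert this using 2
        ring
      calc (a n - f n) ^ 2 = |a n - f n| ^ 2 := (sq_abs _).symm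
        _ ≤ (β * |inner ℝ (w (κ n) - w 0) (X n)|) ^ 2 := by gcongr
        _ = β ^ 2 * inner ℝ (w (κ n) - w 0) (X n) ^ 2 := by rw [mul_pow, sq_abs]
        _ ≤ _ := Finset.single_le_sum
          (f := fun k => (β : ℝ) ^ 2 * inner ℝ (w k - w 0) (X n) ^ 2)
          (fun k _ => by positivity) (Finset.mem_range.2 (hκ n))
    calc _ ≤ ∑ n, ∑ k ∈ Finset.range K, β ^ 2 * inner ℝ (w k - w 0) (X n) ^ 2 :=
          Finset.sum_le_sum fun n _ => h1 n
      _ = ∑ k ∈ Finset.range K, β ^ 2 * ∑ n, inner ℝ (w k - w 0) (X n) ^ 2 := by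
          rw [Finset.sum_comm]; simp only [Finset.mul_sum]
      _ ≤ ∑ k ∈ Finset.range K, β ^ 2 * (σ ^ 2 * (h ^ 2 * σ ^ 2 * ∑ n, a n ^ 2)) := by
          refine Finset.sum_le_sum fun k hk => ?_
          have := hdist k (Finset.mem_range.1 hk).le
          have h3 := sum_inner_sq_le X (w k - w 0)
          gcongr
          exact h3.trans (by gcongr)
      _ = K * (h * β * σ ^ 2) ^ 2 * ∑ n, a n ^ 2 := by simp; ring
      _ ≤ K ^ 2 * (h * β * σ ^ 2) ^ 2 * ∑ n, a n ^ 2 := by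
          gcongr
          nlinarith
      _ = _ := by rw [hq]; ring
  have hnorm : ∀ c : Fin N → ℝ, ‖WithLp.toLp 2 c‖ ^ 2 = ∑ n, c n ^ 2 := fun c =>
    EuclideanSpace.real_norm_sq_eq _
  have herr' : ‖WithLp.toLp 2 (a - f)‖ ≤ q * ‖WithLp.toLp 2 a‖ := by
    refine le_of_sq_le_sq ?_ (by positivity)
    rw [mul_pow, hnorm, hnorm]
    exact herr
  -- From `‖a‖ ≤ ‖f‖ + q ‖a‖` with `q < 1/2`.
  have haf : ‖WithLp.toLp 2 a‖ ≤ 2 * ‖WithLp.toLp 2 f‖ := by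
    have : WithLp.toLp 2 a = WithLp.toLp 2 f + WithLp.toLp 2 (a - f) := by
      rw [← WithLp.toLp_add]; simp
    have h1 : ‖WithLp.toLp 2 a‖ ≤ ‖WithLp.toLp 2 f‖ + ‖WithLp.toLp 2 (a - f)‖ := by
      conv_lhs => rw [this]
      exact norm_add_le _ _
    nlinarith [norm_nonneg (WithLp.toLp 2 a)]
  set G := negGrad X ℓ (w 0) with hG
  have hfG : ‖WithLp.toLp 2 f‖ ^ 2 ≤ ‖G‖ ^ 2 / γ ^ 2 := by
    rw [hnorm]
    simpa [hf] using sum_deriv_sq_le hℓ hN hX (w 0)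
  have hfG' : ‖WithLp.toLp 2 f‖ ≤ ‖G‖ / γ :=
    le_of_sq_le_sq (by rwa [div_pow]) (by positivity)
  refine ⟨hwK, ?_, hdist, ?_⟩
  · rw [← hnorm]
    calc ‖WithLp.toLp 2 a‖ ^ 2 ≤ (2 * ‖WithLp.toLp 2 f‖) ^ 2 := by gcongr
      _ = 4 * ‖WithLp.toLp 2 f‖ ^ 2 := by ring
      _ ≤ _ := by gcongr
  · set ρ := 2 * q * σ / γ with hρ
    have hρ0 : 0 ≤ ρ := by positivity
    -- The epoch is one full gradient step with the error `E`, which is at most `ρ` times the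
    -- gradient.
    set E := ∑ n, (a n - f n) • X n with hE
    have hEG : ‖E‖ ≤ ρ * ‖G‖ := by
      calc ‖E‖ ≤ σ * ‖WithLp.toLp 2 (a - f)‖ :=
            norm_sum_smul_le_sigmaMax X (WithLp.toLp 2 (a - f))
        _ ≤ σ * (q * (2 * (‖G‖ / γ))) := by
          gcongr
          refine herr'.trans ?_
          gcongr
          exact haf.trans (by gcongr)
        _ = _ := by rw [hρ]; ring
    have hsum : ∑ n, a n • X n = G + E := by
      rw [hG, negGrad, hE, ← Finset.sum_add_distrib]
      refine Finset.sum_congr rfl fun n _ => ?_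
      rw [← add_smul]
      simp [hf]
    rw [hwK, hsum]
    refine (empLoss_add_le hℓ X _ _).trans ?_
    rw [← hG, inner_smul_right, inner_add_right, real_inner_self_eq_norm_sq, norm_smul,
      Real.norm_eq_abs, abs_of_pos hh]
    have h1 : -(ρ * ‖G‖ ^ 2) ≤ inner ℝ G E := by
      have := neg_le_of_abs_le (abs_real_inner_le_norm G E)
      nlinarith [norm_nonneg G]
    have h2 : ‖G + E‖ ≤ (1 + ρ) * ‖G‖ := (norm_add_le _ _).trans (by linarith)
    have h3 : β * σ ^ 2 / 2 * (h * ‖G + E‖) ^ 2 ≤ β * σ ^ 2 / 2 * (h * ((1 + ρ) * ‖G‖)) ^ 2 := by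
      gcongr
    have h4 : h * -(ρ * ‖G‖ ^ 2) ≤ h * inner ℝ G E := by gcongr
    calc _ ≤ empLoss X ℓ (w 0) - h * (‖G‖ ^ 2 - ρ * ‖G‖ ^ 2) +
          β * σ ^ 2 / 2 * (h * ((1 + ρ) * ‖G‖)) ^ 2 := by linarith
      _ = _ := by ring

/-- The nondegenerate situation in which the limits of SGD are computed: positive dual variables on
the support vectors, which span the data, and the residual limit `wtilde` for the starting point
`w0`. -/
structure IsRegularLimit (X : Dataset N d) (what : EuclideanSpace ℝ (Fin d)) (α : Fin N → ℝ)
    (w0 wtilde : EuclideanSpace ℝ (Fin d)) : Prop where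
  one_le : ∀ n, 1 ≤ inner ℝ what (X n)
  dual : IsSVMDual X what α
  pos : ∀ n ∈ supportIdx X what, 0 < α n
  mem_span : ∀ n, X n ∈ supportSpan X what
  exp_eq : ∀ n ∈ supportIdx X what, Real.exp (-inner ℝ (X n) wtilde) = α n
  start_mem : w0 - wtilde ∈ supportSpan X what

theorem IsRegularLimit.linearlySeparable {X : Dataset N d}
    {what w0 wtilde : EuclideanSpace ℝ (Fin d)} {α : Fin N → ℝ} (H : IsRegularLimit X what α w0 wtilde) : LinearlySeparable X :=
  ⟨what, fun n => one_pos.trans_le (H.one_le n)⟩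

/-- If `β` were zero, the derivative would be constant and negative, yet tend to zero. -/
theorem IsSmoothMonotoneLoss.smoothness_pos {ℓ : ℝ → ℝ} {β : ℝ≥0}
    (hℓ : IsSmoothMonotoneLoss ℓ β) : 0 < (β : ℝ) := by
  by_contra hcon
  have h0 : (β : ℝ) = 0 := le_antisymm (not_lt.1 hcon) β.coe_nonneg
  have h1 : ∀ u, deriv ℓ u = deriv ℓ 0 := fun u => by
    have := hℓ.smooth.dist_le_mul u 0
    rw [h0, zero_mul] at this
    exact dist_le_zero.1 this
  have h2 := hℓ.deriv_tendsto_zero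
  rw [show deriv ℓ = fun _ => deriv ℓ 0 from funext h1] at h2
  exact (hℓ.deriv_neg 0).ne (tendsto_nhds_unique tendsto_const_nhds h2)

theorem tendsto_zero_of_summable_sq {f : ℕ → ℝ} (hf : Summable fun t => f t ^ 2) :
    Tendsto f atTop (𝓝 0) := by
  rw [tendsto_zero_iff_abs_tendsto_zero]
  simpa [Real.sqrt_sq_eq_abs, Function.comp_def] using hf.tendsto_atTop_zero.sqrt

theorem tendsto_div_natCast_div (h : ℝ) (hh : 0 < h) {K : ℕ} (hK : 0 < K) :
    Tendsto (fun t : ℕ => Real.log (h * ((t / K : ℕ) : ℝ)) - Real.log (h * (t / K))) atTop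
      (𝓝 0) := by
  apply tendsto_log_sub_log
  have hK' : (0 : ℝ) < K := by exact_mod_cast hK
  have h1 : Tendsto (fun t : ℕ => (t : ℝ) / K) atTop atTop :=
    tendsto_natCast_atTop_atTop.atTop_div_const hK'
  refine ((tendsto_nat_floor_div_atTop (R := ℝ)).comp h1).congr fun t => ?_
  simp only [Function.comp, Nat.floor_div_eq_div]
  rw [mul_div_mul_left _ _ hh.ne']

/-- The iterates at epoch ends obey the recursion of `log_asymptotics`, with the derivatives met
during the epoch as coefficients. These are square-summable by telescoping the decrease of the loss.
The motion within an epoch tends to zero, so evaluating a derivative at an intermediate iterate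
changes the exponential only by a factor tending to `1`, and the expansion at epoch ends extends to
all times. -/
theorem hasLogAsymptotics_of_caseWithout {X : Dataset N d}
    {what w0 wtilde : EuclideanSpace ℝ (Fin d)} {α : Fin N → ℝ} (hN : 0 < N)
    (H : IsRegularLimit X what α w0 wtilde) {ℓ : ℝ → ℝ} {β : ℝ≥0}
    (hℓ : IsSmoothMonotoneLoss ℓ β) (htail : HasTightExpTail (fun u => -deriv ℓ u))
    {η : ℝ} {B K : ℕ} {batch : ℕ → Finset (Fin N)} (hcase : CaseWithout X β η B K batch) :
    HasLogAsymptotics (sgd X ℓ η B batch w0) what wtilde η B K := by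
  obtain ⟨hη, hBK, hstep, hsamp⟩ := hcase
  have hX := H.linearlySeparable
  have hγ := margin_pos hN hX
  have hγσ := margin_le_sigmaMax hN hX
  have hB : 0 < B := Nat.pos_of_ne_zero (by rintro rfl; omega)
  have hK : 0 < K := Nat.pos_of_ne_zero (by rintro rfl; omega)
  have hh : 0 < η / B := by positivity
  have hβ := hℓ.smoothness_pos
  set h := η / B with hdef
  set w := sgd X ℓ η B batch w0 with hw
  have hsgd : ∀ t, w (t + 1) = w t - h • ∑ n ∈ batch t, deriv ℓ (inner ℝ (w t) (X n)) • X n :=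
    fun t => rfl
  choose κ hκ hS using hsamp.exists_index hBK
  let a : ℕ → Fin N → ℝ := fun u n => -deriv ℓ (inner ℝ (w (K * u + κ u n)) (X n))
  have hep := fun u : ℕ => epoch_bounds hℓ hN hX hh hK hβ hstep (w := fun k => w (K * u + k))
    (S := fun k => batch (K * u + k)) (hκ u) (hS u) (fun k _ => hsgd (K * u + k)) (a := a u)
    (fun n => rfl)
  have hc0 := epoch_decrease_pos hγ hγσ hβ hh (by exact_mod_cast hK : (1 : ℝ) ≤ K)
    (hstep.trans_le (min_le_right _ _))
  set c := h * ((1 - 2 * (h * β * sigmaMax X ^ 2 * K) * sigmaMax X / margin X)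
        - β * sigmaMax X ^ 2 / 2 * h *
          (1 + 2 * (h * β * sigmaMax X ^ 2 * K) * sigmaMax X / margin X) ^ 2) with hc
  let v : ℕ → EuclideanSpace ℝ (Fin d) := fun u => w (K * u)
  let G : ℕ → ℝ := fun u => ‖negGrad X ℓ (v u)‖ ^ 2
  have hdesc : ∀ u, empLoss X ℓ (v (u + 1)) ≤ empLoss X ℓ (v u) - c * G u := fun u => (hep u).2.2.2
  have hGsum : Summable G := by
    refine summable_of_sum_range_le (c := empLoss X ℓ (v 0) / c) (fun u => by positivity)
      fun n => ?_
    have : c * ∑ u ∈ Finset.range n, G u ≤ empLoss X ℓ (v 0) - empLoss X ℓ (v n) := by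
      induction n with
      | zero => simp
      | succ n ih => rw [Finset.sum_range_succ, mul_add]; linarith [hdesc n]
    rw [le_div_iff₀ hc0, mul_comm]
    linarith [empLoss_nonneg hℓ X (v n)]
  have hasum : Summable fun u => ∑ n, a u n ^ 2 :=
    Summable.of_nonneg_of_le (fun u => by positivity) (fun u => (hep u).2.1)
      ((hGsum.div_const (margin X ^ 2)).mul_left 4)
  have ha2 : ∀ n, Summable fun u => a u n ^ 2 := fun n =>
    Summable.of_nonneg_of_le (fun u => by positivity)
      (fun u => Finset.single_le_sum (f := fun n => a u n ^ 2) (fun n _ => sq_nonneg _)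
        (Finset.mem_univ n)) hasum
  have ha0 : ∀ n, Tendsto (fun u => a u n) atTop (𝓝 0) := fun n =>
    tendsto_zero_of_summable_sq (ha2 n)
  have hinf : ∀ n, Tendsto (fun u => inner ℝ (w (K * u + κ u n)) (X n)) atTop atTop := fun n =>
    tendsto_atTop_of_deriv_tendsto_zero hℓ (by simpa [a] using (ha0 n).neg)
  have hsmall : Tendsto (fun u => √(h ^ 2 * sigmaMax X ^ 2 * ∑ n, a u n ^ 2)) atTop (𝓝 0) := by
    simpa using (hasum.tendsto_atTop_zero.const_mul (h ^ 2 * sigmaMax X ^ 2)).sqrt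
  have hdist : ∀ u, ∀ k ≤ K, ‖w (K * u + k) - v u‖ ≤
      √(h ^ 2 * sigmaMax X ^ 2 * ∑ n, a u n ^ 2) := fun u k hk =>
    Real.le_sqrt_of_sq_le ((hep u).2.2.1 k hk)
  have hmain : Tendsto (fun u : ℕ => v u - (Real.log (h * u) • what + wtilde)) atTop (𝓝 0) := by
    refine log_asymptotics H.one_le H.dual H.pos H.mem_span H.exp_eq hh (fun u => (hep u).1)
      (fun u n => ?_) (fun n => ?_) ha2 H.start_mem
    · linarith [hℓ.deriv_neg (inner ℝ (w (K * u + κ u n)) (X n))]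
    · have h1 := htail.tendsto_mul_exp.comp (hinf n)
      have h2 : Tendsto (fun u => inner ℝ (v u - w (K * u + κ u n)) (X n)) atTop (𝓝 0) := by
        refine squeeze_zero_norm (fun u => ?_) (by simpa using hsmall.mul_const ‖X n‖)
        refine (norm_inner_le_norm _ _).trans ?_
        rw [norm_sub_rev]
        gcongr
        exact hdist u _ (hκ u n).le
      have h3 := h1.mul ((Real.continuous_exp.tendsto 0).comp h2)
      rw [Real.exp_zero, one_mul] at h3
      refine h3.congr fun u => ?_
      simp only [Function.comp, a]
      rw [mul_assoc, ← Real.exp_add, inner_sub_left]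
      congr 2
      ring
  have hdivK : Tendsto (fun t : ℕ => t / K) atTop atTop := Nat.tendsto_div_const_atTop hK.ne'
  have h1 := hmain.comp hdivK
  have h2 : Tendsto (fun t => w t - v (t / K)) atTop (𝓝 0) := by
    refine squeeze_zero_norm (fun t => ?_) (hsmall.comp hdivK)
    have := hdist (t / K) (t % K) (Nat.mod_lt _ hK).le
    rwa [Nat.div_add_mod] at this
  have h3 := (tendsto_div_natCast_div h hh hK).smul_const what
  have h4 := (h1.add h2).add h3
  simp only [add_zero, zero_smul] at h4
  refine h4.congr fun t => ?_
  simp only [Function.comp]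
  rw [sub_smul]
  abel

/-! ### Time measured in epochs. -/

theorem tendsto_log_floor (h : ℝ) (hh : 0 < h) {K : ℕ} (hK : 0 < K) :
    Tendsto (fun τ : ℝ => Real.log (h * ((⌊K * τ⌋₊ : ℝ) / K)) - Real.log (h * τ)) atTop
      (𝓝 0) := by
  apply tendsto_log_sub_log
  have hK' : (0 : ℝ) < K := by exact_mod_cast hK
  have h1 : Tendsto (fun τ : ℝ => (K : ℝ) * τ) atTop atTop := tendsto_id.const_mul_atTop hK'
  refine ((tendsto_nat_floor_div_atTop (R := ℝ)).comp h1).congr fun τ => ?_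
  simp only [Function.comp]
  rw [mul_div_mul_left _ _ hh.ne', div_div]

/-- Read at epoch time `τ`, both expansions become `log((η/B) τ) what + wtilde + o(1)` with the same
`η/B`. -/
theorem AgreePerEpoch.of_hasLogAsymptotics {w₁ w₂ : ℕ → EuclideanSpace ℝ (Fin d)}
    {what wtilde : EuclideanSpace ℝ (Fin d)} {η₁ η₂ : ℝ} {B₁ B₂ K₁ K₂ : ℕ}
    (h₁ : HasLogAsymptotics w₁ what wtilde η₁ B₁ K₁)
    (h₂ : HasLogAsymptotics w₂ what wtilde η₂ B₂ K₂)
    (hK₁ : 0 < K₁) (hK₂ : 0 < K₂) (hpos : 0 < η₁ / B₁) (heq : η₁ / B₁ = η₂ / B₂) :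
    AgreePerEpoch w₁ w₂ K₁ K₂ := by
  have hfl : ∀ {K : ℕ}, 0 < K → Tendsto (fun τ : ℝ => ⌊K * τ⌋₊) atTop atTop := fun hK =>
    tendsto_nat_floor_atTop.comp (tendsto_id.const_mul_atTop (by exact_mod_cast hK))
  have h1 := h₁.comp (hfl hK₁)
  have h2 := h₂.comp (hfl hK₂)
  have h3 := ((tendsto_log_floor _ hpos hK₁).sub (tendsto_log_floor _ hpos hK₂)).smul_const what
  have h4 := (h1.sub h2).add h3
  simp only [sub_zero, zero_smul, add_zero] at h4
  refine h4.congr fun τ => ?_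
  simp only [Function.comp, ← heq, sub_smul]
  abel

/-! ### Vectors with prescribed inner products. -/

section Gram

variable {ι E : Type*} [NormedAddCommGroup E] [InnerProductSpace ℝ E]

theorem eq_of_mem_span_of_inner_eq {v : ι → E} {a b : E}
    (ha : a ∈ Submodule.span ℝ (Set.range v)) (hb : b ∈ Submodule.span ℝ (Set.range v))
    (h : ∀ i, inner ℝ a (v i) = inner ℝ b (v i)) : a = b := by
  have h2 : ∀ u ∈ Submodule.span ℝ (Set.range v), inner ℝ (a - b) u = 0 := by
    intro u hu
    induction hu using Submodule.span_induction with
    | mem x hx => obtain ⟨i, rfl⟩ := hx; rw [inner_sub_left, h i, sub_self]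
    | zero => simp
    | add x y _ _ hx hy => rw [inner_add_right, hx, hy, add_zero]
    | smul c x _ hx => rw [inner_smul_right, hx, mul_zero]
  exact sub_eq_zero.1 (inner_self_eq_zero.1 (h2 _ (Submodule.sub_mem _ ha hb)))

variable [Fintype ι]

open Classical in
/-- The vector in the span of a linearly independent family `v` with prescribed inner products
`y`. -/
noncomputable def gramSolve (v : ι → E) (y : ι → ℝ) : E :=
  ∑ i, ((Matrix.gram ℝ v)⁻¹.mulVec y) i • v i

theorem gramSolve_mem_span (v : ι → E) (y : ι → ℝ) :
    gramSolve v y ∈ Submodule.span ℝ (Set.range v) :=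
  Submodule.sum_mem _ fun i _ => Submodule.smul_mem _ _ (Submodule.subset_span ⟨i, rfl⟩)

theorem inner_gramSolve {v : ι → E} (hv : LinearIndependent ℝ v) (y : ι → ℝ) (j : ι) :
    inner ℝ (gramSolve v y) (v j) = y j := by
  classical
  have hdet : IsUnit (Matrix.gram ℝ v).det :=
    isUnit_iff_ne_zero.2 (Matrix.det_gram_ne_zero_iff_linearIndependent.2 hv)
  have h1 : (Matrix.gram ℝ v).mulVec ((Matrix.gram ℝ v)⁻¹.mulVec y) = y := by
    rw [Matrix.mulVec_mulVec, Matrix.mul_nonsing_inv _ hdet, Matrix.one_mulVec]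
  conv_rhs => rw [← h1]
  rw [gramSolve, sum_inner, Matrix.mulVec, dotProduct]
  refine Finset.sum_congr rfl fun i _ => ?_
  rw [inner_smul_left, Matrix.gram_apply, real_inner_comm, mul_comm]
  simp only [conj_trivial]

/-- The inverse Gram matrix is the inverse determinant times the adjugate, hence a measurable
function of the inner products. This includes dependent families, where it has the default value
zero. -/
theorem measurable_gramSolve {Ω : Type*} [MeasurableSpace Ω] [MeasurableSpace E] [BorelSpace E]
    [SecondCountableTopology E] {v : Ω → ι → E} (hv : ∀ i, Measurable fun ω => v ω i)
    (y : ι → ℝ) : Measurable fun ω => gramSolve (v ω) y := by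
  classical
  have hgram : Measurable fun ω => (fun i j => inner ℝ (v ω i) (v ω j) : ι → ι → ℝ) :=
    measurable_pi_lambda _ fun i => measurable_pi_lambda _ fun j => (hv i).inner (hv j)
  have hdet : Measurable fun ω => (Matrix.gram ℝ (v ω)).det := by
    have : Continuous fun M : ι → ι → ℝ => (Matrix.of M).det :=
      Continuous.matrix_det continuous_id
    exact this.measurable.comp hgram
  have hadj : ∀ i j, Measurable fun ω => (Matrix.gram ℝ (v ω)).adjugate i j := by
    intro i j
    have : Continuous fun M : ι → ι → ℝ => (Matrix.of M).adjugate i j :=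
      (Continuous.matrix_adjugate continuous_id).matrix_elem i j
    exact this.measurable.comp hgram
  unfold gramSolve
  refine Finset.measurable_sum _ fun i _ => Measurable.smul ?_ (hv i)
  simp only [Matrix.mulVec, dotProduct, Matrix.inv_def, Ring.inverse_eq_inv', Matrix.smul_apply,
    smul_eq_mul]
  refine Finset.measurable_sum _ fun j _ => Measurable.mul_const (Measurable.mul ?_ ?_) _
  · exact hdet.inv
  · exact hadj i j

end Gram

/-! ### Generic datasets. -/

/-- The set is an affine subspace that misses the origin, hence proper. The cases `v = 0` and `d =
0` need no separate treatment. -/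
theorem volume_inner_eq_one (v : EuclideanSpace ℝ (Fin d)) :
    volume {x : EuclideanSpace ℝ (Fin d) | inner ℝ v x = 1} = 0 := by
  let s : AffineSubspace ℝ (EuclideanSpace ℝ (Fin d)) :=
    { carrier := {x | inner ℝ v x = 1}
      smul_vsub_vadd_mem' := by
        intro c p₁ p₂ p₃ h₁ h₂ h₃
        simp only [Set.mem_ofPred_eq] at h₁ h₂ h₃ ⊢
        simp [inner_add_right, inner_smul_right, inner_sub_right, h₁, h₂, h₃] }
  refine Measure.addHaar_affineSubspace volume s fun h => ?_
  have : (0 : EuclideanSpace ℝ (Fin d)) ∈ s := h ▸ AffineSubspace.mem_top _ _ _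
  have h0 : inner ℝ v (0 : EuclideanSpace ℝ (Fin d)) = 1 := this
  simp at h0

/-- The vector solved for does not involve the sample `m`. With the other samples fixed, the
exceptional `x_m` lie in a null hyperplane, and Fubini concludes. -/
theorem ae_inner_gramSolve_ne_one (A : Finset (Fin N)) {m : Fin N} (hm : m ∉ A) :
    ∀ᵐ X : Dataset N d, inner ℝ (gramSolve (fun i : A => X i) 1) (X m) ≠ 1 := by
  obtain ⟨n, rfl⟩ : ∃ n, N = n + 1 := ⟨N - 1, by have := m.2; omega⟩
  let T : Set (Dataset (n + 1) d) := {X | inner ℝ (gramSolve (fun i : A => X i) 1) (X m) = 1}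
  have hT : MeasurableSet T :=
    ((measurable_gramSolve (fun i : A => measurable_pi_apply (i : Fin (n + 1))) 1).inner
      (measurable_pi_apply m)) (measurableSet_singleton 1)
  suffices volume T = 0 by
    rw [ae_iff]
    simpa [T] using this
  have he := (volume_preserving_piFinSuccAbove
    (fun _ : Fin (n + 1) => EuclideanSpace ℝ (Fin d)) m).symm
  rw [← he.measure_preimage hT.nullMeasurableSet]
  change (volume.prod volume) _ = 0
  rw [Measure.prod_apply_symm (he.measurable hT)]
  refine (lintegral_congr fun Y => ?_).trans lintegral_zero
  -- The value `0` inserted at `m` is a filler that `A` never reads.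
  let v := gramSolve (fun i : A => (m.insertNth 0 Y : Dataset (n + 1) d) i) 1
  refine measure_mono_null ?_ (volume_inner_eq_one v)
  intro x hx
  have h1 : inner ℝ (gramSolve (fun i : A => (m.insertNth x Y : Dataset (n + 1) d) i) 1)
      ((m.insertNth x Y : Dataset (n + 1) d) m) = 1 := hx
  have h2 : (fun i : A => (m.insertNth x Y : Dataset (n + 1) d) i) =
      fun i : A => (m.insertNth 0 Y : Dataset (n + 1) d) i := by
    ext1 i
    obtain ⟨j, hj⟩ := Fin.exists_succAbove_eq (x := (i : Fin (n + 1))) (y := m)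
      (fun h => hm (h ▸ i.2))
    rw [← hj]
    simp
  rw [h2] at h1
  simpa [v] using h1

/-- Existence of a max-margin separator, as a positive combination of linearly independent support
vectors. -/
theorem exists_linearIndependent_combination {X : Dataset N d} (hN : 0 < N)
    (hX : LinearlySeparable X) :
    ∃ (what : EuclideanSpace ℝ (Fin d)) (A : Finset (Fin N)) (α : Fin N → ℝ),
      (∀ n, 1 ≤ inner ℝ what (X n)) ∧ (∀ n ∈ A, inner ℝ what (X n) = 1) ∧ (∀ n ∈ A, 0 < α n) ∧
      (∀ n ∉ A, α n = 0) ∧ what = ∑ n, α n • X n ∧ LinearIndependent ℝ (fun i : A => X i) := by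
  classical
  obtain ⟨ws, hws⟩ := hX
  set C := convexHull ℝ (Set.range X) with hC
  have hCc : IsCompact C := (Set.finite_range X).isCompact_convexHull ℝ
  have hCconv : Convex ℝ C := convex_convexHull ℝ _
  have hXC : ∀ n, X n ∈ C := fun n => subset_convexHull ℝ _ ⟨n, rfl⟩
  -- `p` is the point of the convex hull nearest to the origin, and the separator will be `p /
  -- ‖p‖²`. The variational inequality of the projection gives the margin constraints.
  obtain ⟨p, hpC, hp⟩ := exists_norm_eq_iInf_of_complete_convex ⟨_, hXC ⟨0, hN⟩⟩
    hCc.isComplete hCconv 0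
  rw [norm_eq_iInf_iff_real_inner_le_zero hCconv hpC] at hp
  have hpn : ∀ n, ‖p‖ ^ 2 ≤ inner ℝ p (X n) := fun n => by
    have := hp _ (hXC n)
    rw [zero_sub, inner_neg_left, inner_sub_right, real_inner_self_eq_norm_sq] at this
    linarith
  have hp0 : p ≠ 0 := by
    have hsub : C ⊆ {x | 0 < inner ℝ ws x} := by
      refine convexHull_min ?_ ?_
      · rintro _ ⟨n, rfl⟩
        exact hws n
      · exact convex_halfSpace_gt (innerSL ℝ ws).toLinearMap.isLinear 0
    rintro rfl
    simpa using hsub hpC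
  have hpp : 0 < ‖p‖ ^ 2 := by have := norm_pos_iff.2 hp0; positivity
  -- Carathéodory, with affinely independent points and strictly positive weights.
  obtain ⟨ι, _, z, c, hz, haff, hc, hc1, hcp⟩ := eq_pos_convex_span_of_mem_convexHull hpC
  choose idx hidx using fun i => hz ⟨i, rfl⟩
  have hinj : Function.Injective idx := fun i j h => haff.injective (by rw [← hidx, ← hidx, h])
  -- These numbers are all at least `‖p‖²` and their weighted average equals it.
  have hzi : ∀ i, inner ℝ p (z i) = ‖p‖ ^ 2 := by
    have h1 : ∑ i, c i * ‖p‖ ^ 2 = ∑ i, c i * inner ℝ p (z i) := by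
      rw [← Finset.sum_mul, hc1, one_mul, ← real_inner_self_eq_norm_sq]
      nth_rewrite 2 [← hcp]
      simp [inner_sum, inner_smul_right]
    have h2 := (Finset.sum_eq_sum_iff_of_le (fun i _ =>
      mul_le_mul_of_nonneg_left (hidx i ▸ hpn (idx i)) (hc i).le)).1 h1
    intro i
    exact (mul_left_cancel₀ (hc i).ne' (h2 i (Finset.mem_univ i))).symm
  have hli : LinearIndependent ℝ z := by
    rw [Fintype.linearIndependent_iff]
    intro g hg
    -- All `z i` lie on a hyperplane that misses the origin, so every linear relation among them is
    -- an affine one.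
    have hsum : ∑ i, g i = 0 := by
      have h1 : inner ℝ p (∑ i, g i • z i) = (∑ i, g i) * ‖p‖ ^ 2 := by
        rw [inner_sum, Finset.sum_mul]
        exact Finset.sum_congr rfl fun i _ => by rw [inner_smul_right, hzi]
      rw [hg, inner_zero_right] at h1
      exact (mul_eq_zero.1 h1.symm).resolve_right hpp.ne'
    intro i
    exact (affineIndependent_iff.1 haff) Finset.univ g hsum hg i (Finset.mem_univ i)
  let A : Finset (Fin N) := Finset.univ.image idx
  let α : Fin N → ℝ := fun n => (∑ i, if idx i = n then c i else 0) / ‖p‖ ^ 2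
  have hα : ∀ i, α (idx i) = c i / ‖p‖ ^ 2 := fun i => by
    simp [α, hinj.eq_iff]
  have hinnerp : ∀ x, inner ℝ ((‖p‖ ^ 2)⁻¹ • p) x = inner ℝ p x / ‖p‖ ^ 2 := fun x => by
    rw [inner_smul_left, conj_trivial, inv_mul_eq_div]
  refine ⟨(‖p‖ ^ 2)⁻¹ • p, A, α, ?_, ?_, ?_, ?_, ?_, ?_⟩
  · intro n
    rw [hinnerp, le_div_iff₀ hpp, one_mul]
    exact hpn n
  · intro n hn
    obtain ⟨i, -, rfl⟩ := Finset.mem_image.1 hn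
    rw [hinnerp, hidx, hzi, div_self hpp.ne']
  · intro n hn
    obtain ⟨i, -, rfl⟩ := Finset.mem_image.1 hn
    rw [hα]
    exact div_pos (hc i) hpp
  · intro n hn
    have : ∀ i, idx i ≠ n := fun i h => hn (Finset.mem_image.2 ⟨i, Finset.mem_univ i, h⟩)
    simp [α, this]
  · conv_lhs => rw [← hcp, Finset.smul_sum]
    simp only [α, Finset.sum_div, Finset.sum_smul, ite_div, zero_div, ite_smul, zero_smul]
    rw [Finset.sum_comm]
    refine Finset.sum_congr rfl fun i _ => ?_
    simp [hidx, smul_smul, div_eq_inv_mul, hcp]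
  · have hex : ∀ a : A, ∃ i, idx i = a := fun a => by
      obtain ⟨i, -, h⟩ := Finset.mem_image.1 a.2
      exact ⟨i, h⟩
    choose r hr using hex
    have hrinj : Function.Injective r := fun a b h => Subtype.ext (by rw [← hr, ← hr, h])
    have : (fun a : A => X a) = z ∘ r := by
      ext1 a
      simp [← hidx, hr]
    rw [this]
    exact hli.comp r hrinj

/-! ### Duality, and uniqueness of the separator, of the dual variables and of the residual limit.
-/

/-- Complementary slackness: both sides are sums weighted by `α`, and where `α` can be nonzero,
`whatᵀ x_n = 1 ≤ wᵀ x_n`. -/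
theorem IsSVMDual.inner_le {X : Dataset N d} {what : EuclideanSpace ℝ (Fin d)} {α : Fin N → ℝ}
    (h : IsSVMDual X what α) {w : EuclideanSpace ℝ (Fin d)} (hw : ∀ n, 1 ≤ inner ℝ w (X n)) :
    ‖what‖ ^ 2 ≤ inner ℝ w what := by
  obtain ⟨h0, hS, hsum⟩ := h
  have e : ∀ w, inner ℝ w what = ∑ n, α n * inner ℝ w (X n) := fun w => by
    conv_lhs => rw [hsum]
    simp [inner_sum, inner_smul_right]
  rw [← real_inner_self_eq_norm_sq, e, e]
  refine Finset.sum_le_sum fun n _ => ?_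
  by_cases hn : n ∈ supportIdx X what
  · have : inner ℝ what (X n) = 1 := hn
    rw [this]
    exact mul_le_mul_of_nonneg_left (hw n) (h0 n)
  · simp [hS n hn]

/-- The dual certificate gives `‖w - what‖² ≤ ‖w‖² - ‖what‖²` for every feasible `w`, hence
optimality and uniqueness at once. -/
theorem IsSVMDual.isMaxMarginSeparator {X : Dataset N d} {what : EuclideanSpace ℝ (Fin d)}
    {α : Fin N → ℝ} (h : IsSVMDual X what α) (hone : ∀ n, 1 ≤ inner ℝ what (X n)) :
    IsMaxMarginSeparator X what ∧ ∀ v, IsMaxMarginSeparator X v → v = what := by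
  have key : ∀ w : EuclideanSpace ℝ (Fin d), (∀ n, 1 ≤ inner ℝ w (X n)) →
      ‖w - what‖ ^ 2 ≤ ‖w‖ ^ 2 - ‖what‖ ^ 2 := fun w hw => by
    have := h.inner_le hw
    rw [norm_sub_sq_real]
    linarith
  refine ⟨⟨hone, fun w hw => ?_⟩, fun v hv => ?_⟩
  · have := key w hw
    have := sq_nonneg ‖w - what‖
    linarith
  · have h1 := key v hv.1
    have h2 := hv.2 what hone
    have h3 : ‖v - what‖ ^ 2 = 0 := le_antisymm (by linarith) (sq_nonneg _)
    exact sub_eq_zero.1 (norm_eq_zero.1 (pow_eq_zero_iff two_ne_zero |>.1 h3))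

theorem supportSpan_eq_span_range (X : Dataset N d) (what : EuclideanSpace ℝ (Fin d)) :
    supportSpan X what = Submodule.span ℝ (Set.range fun n : supportIdx X what => X n) := by
  rw [supportSpan, Set.image_eq_range]

/-- For almost every separable dataset, the dual variables are positive on the support vectors,
which are linearly independent. -/
theorem ae_exists_pos_dual (hN : 0 < N) : ∀ᵐ X : Dataset N d, LinearlySeparable X →
    ∃ (what : EuclideanSpace ℝ (Fin d)) (α : Fin N → ℝ), (∀ n, 1 ≤ inner ℝ what (X n)) ∧
      IsSVMDual X what α ∧ (∀ n ∈ supportIdx X what, 0 < α n) ∧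
      LinearIndependent ℝ (fun n : supportIdx X what => X n) := by
  have hae : ∀ᵐ X : Dataset N d, ∀ (A : Finset (Fin N)) (m : Fin N), m ∉ A →
      inner ℝ (gramSolve (fun i : A => X i) 1) (X m) ≠ 1 := by
    rw [ae_all_iff]
    intro A
    rw [ae_all_iff]
    intro m
    by_cases hm : m ∈ A
    · exact Eventually.of_forall fun X h => absurd hm h
    · filter_upwards [ae_inner_gramSolve_ne_one A hm] with X hX _ using hX
  filter_upwards [hae] with X hgen hX
  obtain ⟨what, A, α, hone, hA, hpos, hzero, hsum, hli⟩ :=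
    exists_linearIndependent_combination hN hX
  have hwhat : what = gramSolve (fun i : A => X i) 1 := by
    refine eq_of_mem_span_of_inner_eq ?_ (gramSolve_mem_span (fun i : A => X i) 1) fun i => ?_
    · rw [hsum]
      refine Submodule.sum_mem _ fun n _ => ?_
      by_cases hn : n ∈ A
      · exact Submodule.smul_mem _ _ (Submodule.subset_span ⟨⟨n, hn⟩, rfl⟩)
      · simp [hzero n hn]
    · rw [inner_gramSolve hli, hA i i.2]
      rfl
  -- `what` is determined by the samples in `A`, so for a generic dataset no other sample can be a
  -- support vector.
  have hmem : ∀ n, n ∈ supportIdx X what ↔ n ∈ A := by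
    intro n
    refine ⟨fun h => ?_, fun h => hA n h⟩
    by_contra hn
    exact hgen A n hn (hwhat ▸ h)
  refine ⟨what, α, hone, ⟨fun n => ?_, fun n hn => hzero n (fun h => hn ((hmem n).2 h)), hsum⟩,
    fun n hn => hpos n ((hmem n).1 hn), ?_⟩
  · by_cases hn : n ∈ A
    · exact (hpos n hn).le
    · exact (hzero n hn).ge
  · exact hli.comp (fun n : supportIdx X what => (⟨n, (hmem n).1 n.2⟩ : A))
      fun a b h => Subtype.ext (congrArg (fun x : A => (x : Fin N)) h)

theorem IsSVMDual.unique {X : Dataset N d} {what : EuclideanSpace ℝ (Fin d)} {α a : Fin N → ℝ}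
    (h : IsSVMDual X what α) (ha : IsSVMDual X what a)
    (hli : LinearIndependent ℝ (fun n : supportIdx X what => X n)) : a = α := by
  classical
  have e : ∀ c : Fin N → ℝ, (∀ n, n ∉ supportIdx X what → c n = 0) →
      ∑ n, c n • X n = ∑ n : supportIdx X what, c n • X n := fun c hc => by
    rw [← Finset.sum_subset (Finset.subset_univ (supportIdx X what).toFinset)
      (fun n _ hn => by rw [hc n (by simpa using hn), zero_smul])]
    exact Finset.sum_subtype _ (fun n => by simp) _
  have h0 : ∑ n : supportIdx X what, (a n - α n) • X n = 0 := by
    simp only [sub_smul, Finset.sum_sub_distrib]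
    rw [← e a ha.2.1, ← e α h.2.1, ← ha.2.2, ← h.2.2, sub_self]
  ext n
  by_cases hn : n ∈ supportIdx X what
  · exact sub_eq_zero.1 (Fintype.linearIndependent_iff.1 hli _ h0 ⟨n, hn⟩)
  · rw [ha.2.1 n hn, h.2.1 n hn]

theorem IsResidualLimit.sub_mem {X : Dataset N d} {what w0 wtilde : EuclideanSpace ℝ (Fin d)}
    {α : Fin N → ℝ} (h : IsResidualLimit X what α w0 wtilde) :
    wtilde - w0 ∈ supportSpan X what := by
  have := h.2
  rw [sub_eq_zero.1 this]
  exact Submodule.starProjection_apply_mem _ _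

/-- The solution is the vector of the support span with inner products `-log α_n`, plus `(I - P)
w0`, which is orthogonal to the support vectors. The difference of two solutions lies in the span
and is orthogonal to it. -/
theorem exists_unique_residualLimit {X : Dataset N d} {what : EuclideanSpace ℝ (Fin d)}
    {α : Fin N → ℝ} (hpos : ∀ n ∈ supportIdx X what, 0 < α n)
    (hli : LinearIndependent ℝ (fun n : supportIdx X what => X n))
    (w0 : EuclideanSpace ℝ (Fin d)) :
    ∃ wtilde, IsResidualLimit X what α w0 wtilde ∧
      ∀ v, IsResidualLimit X what α w0 v → v = wtilde := by
  classical
  set V := supportSpan X what with hV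
  let v := gramSolve (fun n : supportIdx X what => X n) (fun n => -Real.log (α n))
  have hv : v ∈ V := by
    rw [hV, supportSpan_eq_span_range]
    exact gramSolve_mem_span _ _
  have hex : IsResidualLimit X what α w0 (v + (w0 - V.starProjection w0)) := by
    constructor
    · intro n hn
      have h1 : inner ℝ (X n) v = -Real.log (α n) := by
        rw [real_inner_comm]
        exact inner_gramSolve hli _ ⟨n, hn⟩
      have h2 : inner ℝ (X n) (w0 - V.starProjection w0) = 0 :=
        (Submodule.mem_orthogonal _ _).1 (V.sub_starProjection_mem_orthogonal w0) _
          (mem_supportSpan X what hn)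
      rw [inner_add_right, h1, h2, add_zero, neg_neg, Real.exp_log (hpos n hn)]
    · have h1 : v + (w0 - V.starProjection w0) - w0 = v - V.starProjection w0 := by abel
      have h2 : v - V.starProjection w0 ∈ V :=
        V.sub_mem hv (Submodule.starProjection_apply_mem _ _)
      rw [h1]
      exact sub_eq_zero.2 (Submodule.starProjection_eq_self_iff.2 h2).symm
  refine ⟨_, hex, fun u hu => ?_⟩
  set wt := v + (w0 - V.starProjection w0)
  have h1 : u - wt ∈ V := by
    have : u - wt = (u - w0) - (wt - w0) := by abel
    rw [this]
    exact V.sub_mem hu.sub_mem hex.sub_mem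
  refine sub_eq_zero.1 (eq_zero_of_mem_supportSpan h1 fun n hn => ?_)
  have h2 := (hu.1 n hn).trans (hex.1 n hn).symm
  rw [Real.exp_eq_exp, neg_inj] at h2
  rw [real_inner_comm, inner_sub_right, h2, sub_self]

theorem SupportVectorsSpan.mem_supportSpan {X : Dataset N d} {what : EuclideanSpace ℝ (Fin d)}
    (h : SupportVectorsSpan X what) (n : Fin N) : X n ∈ supportSpan X what := by
  have h1 : supportSpan X what = Submodule.span ℝ (Set.range X) :=
    Submodule.eq_of_le_of_finrank_eq (Submodule.span_mono (Set.image_subset_range _ _)) h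
  rw [h1]
  exact Submodule.subset_span ⟨n, rfl⟩

/-! ### Removal of the sampling noise along a single run. -/

/-- The indicator that the sample `n` belongs to the minibatch `S`. -/
noncomputable def batchInd (S : Finset (Fin N)) (n : Fin N) : ℝ := if n ∈ S then 1 else 0

theorem sum_batchInd_smul {E : Type*} [AddCommGroup E] [Module ℝ E] (S : Finset (Fin N))
    (x : Fin N → E) : ∑ n, batchInd S n • x n = ∑ n ∈ S, x n := by
  simp [batchInd, ite_smul, Finset.sum_ite_mem]

theorem batchInd_sq (S : Finset (Fin N)) (n : Fin N) : batchInd S n ^ 2 = batchInd S n := by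
  unfold batchInd
  split_ifs <;> norm_num

theorem batchInd_nonneg (S : Finset (Fin N)) (n : Fin N) : 0 ≤ batchInd S n := by
  unfold batchInd
  split_ifs <;> norm_num

theorem batchInd_le_one (S : Finset (Fin N)) (n : Fin N) : batchInd S n ≤ 1 := by
  unfold batchInd
  split_ifs <;> norm_num

theorem sgd_succ (X : Dataset N d) (ℓ : ℝ → ℝ) (η : ℝ) (B : ℕ) (batch : ℕ → Finset (Fin N))
    (w0 : EuclideanSpace ℝ (Fin d)) (t : ℕ) :
    sgd X ℓ η B batch w0 (t + 1) = sgd X ℓ η B batch w0 t + (η / B) •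
      ∑ n, (batchInd (batch t) n * -deriv ℓ (inner ℝ (sgd X ℓ η B batch w0 t) (X n))) • X n := by
  simp only [mul_smul, sum_batchInd_smul]
  rw [sgd, sub_eq_add_neg, ← smul_neg, ← Finset.sum_neg_distrib]
  simp only [neg_smul]

/-- If the gradients are square-summable and the centred sampling noise converges along a run, then
the run has the logarithmic asymptotics. -/
theorem hasLogAsymptotics_of_noise {X : Dataset N d}
    {what w0 wtilde : EuclideanSpace ℝ (Fin d)} {α : Fin N → ℝ} (hN : 0 < N)
    (H : IsRegularLimit X what α w0 wtilde) {ℓ : ℝ → ℝ} {β : ℝ≥0}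
    (hℓ : IsSmoothMonotoneLoss ℓ β) (htail : HasTightExpTail (fun u => -deriv ℓ u))
    {η : ℝ} {B K : ℕ} (hh : 0 < η / B) (hK : 0 < K) {batch : ℕ → Finset (Fin N)}
    (hG : Summable fun t => ‖negGrad X ℓ (sgd X ℓ η B batch w0 t)‖ ^ 2)
    (hM : ∀ n, ∃ m, Tendsto (fun t => ∑ s ∈ Finset.range t, (batchInd (batch s) n - 1 / K) *
      -deriv ℓ (inner ℝ (sgd X ℓ η B batch w0 s) (X n))) atTop (𝓝 m)) :
    HasLogAsymptotics (sgd X ℓ η B batch w0) what wtilde η B K := by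
  have hX := H.linearlySeparable
  have hK' : (0 : ℝ) < K := by exact_mod_cast hK
  set w := sgd X ℓ η B batch w0 with hw
  choose m hm using hM
  set M : Fin N → ℕ → ℝ := fun n t => ∑ s ∈ Finset.range t, (batchInd (batch s) n - 1 / K) *
      -deriv ℓ (inner ℝ (w s) (X n)) with hMdef
  let p : ℕ → Fin N → ℝ := fun t n => -deriv ℓ (inner ℝ (w t) (X n))
  have hp2 : ∀ n, Summable fun t => p t n ^ 2 := fun n => by
    refine Summable.of_nonneg_of_le (fun t => by positivity) (fun t => ?_)
      (hG.div_const (margin X ^ 2))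
    refine le_trans ?_ (sum_deriv_sq_le hℓ hN hX (w t))
    simp only [p, neg_sq]
    exact Finset.single_le_sum (f := fun n => deriv ℓ (inner ℝ (w t) (X n)) ^ 2)
      (fun n _ => sq_nonneg _) (Finset.mem_univ n)
  have hinf : ∀ n, Tendsto (fun t => inner ℝ (w t) (X n)) atTop atTop := fun n =>
    tendsto_atTop_of_deriv_tendsto_zero hℓ
      (by simpa [p] using (tendsto_zero_of_summable_sq (hp2 n)).neg)
  -- `e` is the noise still to come. Adding it to the iterate replaces each batch indicator by its
  -- mean `1/K` exactly, and it tends to zero because the noise converges.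
  let e : ℕ → EuclideanSpace ℝ (Fin d) := fun t => (η / B) • ∑ n, (m n - M n t) • X n
  have he : Tendsto e atTop (𝓝 0) := by
    have h1 : ∀ n, Tendsto (fun t => (m n - M n t) • X n) atTop (𝓝 0) := fun n => by
      have := ((tendsto_const_nhds (x := m n)).sub (hm n)).smul_const (X n)
      rwa [sub_self, zero_smul] at this
    simpa using (tendsto_finsetSum Finset.univ fun n _ => h1 n).const_smul (η / B)
  let v : ℕ → EuclideanSpace ℝ (Fin d) := fun t => w t + e t
  have hv : ∀ t, v (t + 1) = v t + (η / B / K) • ∑ n, p t n • X n := by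
    intro t
    simp only [v, e, hw, sgd_succ]
    rw [← hw, add_assoc, add_assoc, ← smul_add, div_eq_mul_one_div (η / (B : ℝ)) (K : ℝ),
      mul_smul, ← smul_add, Finset.smul_sum, ← Finset.sum_add_distrib, ← Finset.sum_add_distrib]
    congr 2
    refine Finset.sum_congr rfl fun n _ => ?_
    rw [smul_smul, ← add_smul, ← add_smul]
    congr 1
    simp only [hMdef, Finset.sum_range_succ, p]
    ring
  have hmain := log_asymptotics H.one_le H.dual H.pos H.mem_span H.exp_eq
    (div_pos hh hK') hv (fun t n => by linarith [hℓ.deriv_neg (inner ℝ (w t) (X n))]) (fun n => ?_)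
    hp2 ?_
  · have h1 := hmain.sub he
    rw [sub_zero] at h1
    refine h1.congr fun t => ?_
    simp only [v]
    rw [div_mul_eq_mul_div, ← mul_div_assoc]
    abel
  · have h1 := htail.tendsto_mul_exp.comp (hinf n)
    have h2 : Tendsto (fun t => inner ℝ (e t) (X n)) atTop (𝓝 0) := by
      simpa using he.inner (tendsto_const_nhds (x := X n))
    have h3 := h1.mul ((Real.continuous_exp.tendsto 0).comp h2)
    rw [Real.exp_zero, one_mul] at h3
    refine h3.congr fun t => ?_
    simp only [Function.comp, p, v]
    rw [mul_assoc, ← Real.exp_add, inner_add_left]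
  · have h1 : v 0 - wtilde = (w0 - wtilde) + e 0 := by
      simp only [v, hw, sgd]
      abel
    rw [h1]
    exact Submodule.add_mem _ H.start_mem (Submodule.smul_mem _ _
      (Submodule.sum_mem _ fun n _ => Submodule.smul_mem _ _ (H.mem_span n)))

/-! ### Sampling with replacement: decrease in expectation and martingale noise. -/

section Random

variable {Ω : Type*} [mΩ : MeasurableSpace Ω] {μ : Measure Ω}
  {B : ℕ} {batch : ℕ → Ω → Finset (Fin N)}

/-- The information on the minibatches that have been drawn before each iteration. -/
def SamplingWithReplacement.filtration (hs : SamplingWithReplacement μ B batch) :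
    Filtration ℕ mΩ where
  seq t := ⨆ s ∈ Set.Iio t, MeasurableSpace.comap (batch s) ⊤
  mono' _ _ hst := biSup_mono fun _ hi => lt_of_lt_of_le hi hst
  le' _ := iSup₂_le fun s _ => (hs.measurable s).comap_le

theorem SamplingWithReplacement.measurable_batch (hs : SamplingWithReplacement μ B batch)
    {s t : ℕ} (hst : s < t) : Measurable[hs.filtration t, ⊤] (batch s) := by
  refine Measurable.of_comap_le ?_
  exact le_iSup₂_of_le (f := fun s (_ : s ∈ Set.Iio t) => MeasurableSpace.comap (batch s) ⊤)
    s hst le_rfl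

theorem SamplingWithReplacement.measurable_batchInd (hs : SamplingWithReplacement μ B batch)
    {s t : ℕ} (hst : s < t) (n : Fin N) :
    Measurable[hs.filtration t] fun ω => batchInd (batch s ω) n :=
  (measurable_from_top (f := fun S : Finset (Fin N) => batchInd S n)).comp
    (hs.measurable_batch hst)

theorem SamplingWithReplacement.indep_filtration (hs : SamplingWithReplacement μ B batch)
    (t : ℕ) : Indep (hs.filtration t) (MeasurableSpace.comap (batch t) ⊤) μ := by
  have h1 := indep_iSup_of_disjoint (fun s => (hs.measurable s).comap_le)
    (show iIndep (fun s => MeasurableSpace.comap (batch s) ⊤) μ from hs.indep)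
    (S := Set.Iio t) (T := {t}) (by simp)
  rw [iSup_singleton] at h1
  exact h1

/-- The `N` equal probabilities add up to the batch size `B`, and `B / N = 1 / K`. -/
theorem SamplingWithReplacement.integral_batchInd [IsProbabilityMeasure μ]
    (hs : SamplingWithReplacement μ B batch) {K : ℕ} (hBK : B * K = N) (hN : 0 < N) (t : ℕ)
    (n : Fin N) : ∫ ω, batchInd (batch t ω) n ∂μ = 1 / K := by
  have hmeas : ∀ n, MeasurableSet {ω | n ∈ batch t ω} := fun n =>
    hs.measurable t (MeasurableSpace.measurableSet_top (s := {S : Finset (Fin N) | n ∈ S}))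
  have hind : ∀ n, (fun ω => batchInd (batch t ω) n) =
      Set.indicator {ω | n ∈ batch t ω} (fun _ => (1 : ℝ)) := fun n => by
    ext ω
    simp [batchInd, Set.indicator_apply]
  have hval : ∀ n, ∫ ω, batchInd (batch t ω) n ∂μ = μ.real {ω | n ∈ batch t ω} := fun n => by
    rw [hind, integral_indicator_const _ (hmeas n)]
    simp
  have hsum : ∑ n, ∫ ω, batchInd (batch t ω) n ∂μ = B := by
    rw [← integral_finsetSum]
    · have : ∀ ω, ∑ n, batchInd (batch t ω) n = B := fun ω => by
        rw [← hs.card_eq t ω]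
        simp [batchInd]
      simp [this]
    · intro n _
      rw [hind]
      exact (integrable_const _).indicator (hmeas n)
  have hconst : ∀ m, ∫ ω, batchInd (batch t ω) m ∂μ = ∫ ω, batchInd (batch t ω) n ∂μ := fun m => by
    rw [hval, hval, Measure.real, Measure.real, hs.uniform t m n]
  simp only [hconst, Finset.sum_const, Finset.card_univ, Fintype.card_fin, nsmul_eq_mul] at hsum
  have hB : (B : ℝ) ≠ 0 := by
    rintro h
    rw [Nat.cast_eq_zero] at h
    subst h
    omega
  have hNr : (N : ℝ) = B * K := by exact_mod_cast hBK.symm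
  have hKr : (K : ℝ) ≠ 0 := by
    rintro h
    rw [Nat.cast_eq_zero] at h
    subst h
    omega
  rw [hNr] at hsum
  rw [eq_div_iff hKr]
  apply mul_left_cancel₀ hB
  linarith

theorem SamplingWithReplacement.integral_batchInd_mul [IsProbabilityMeasure μ]
    (hs : SamplingWithReplacement μ B batch) {K : ℕ} (hBK : B * K = N) (hN : 0 < N) (t : ℕ)
    (n : Fin N) {Z : Ω → ℝ} (hZ : Measurable[hs.filtration t] Z) :
    ∫ ω, batchInd (batch t ω) n * Z ω ∂μ = 1 / K * ∫ ω, Z ω ∂μ := by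
  have hI : Measurable[MeasurableSpace.comap (batch t) ⊤] fun ω => batchInd (batch t ω) n :=
    (measurable_from_top (f := fun S : Finset (Fin N) => batchInd S n)).comp
      (comap_measurable _)
  have hind : IndepFun (fun ω => batchInd (batch t ω) n) Z μ := by
    rw [IndepFun_iff_Indep]
    exact (indep_of_indep_of_le_left (indep_of_indep_of_le_right (hs.indep_filtration t) hI.comap_le)
      hZ.comap_le).symm
  rw [hind.integral_fun_mul_eq_mul_integral
    (hI.mono (hs.measurable t).comap_le le_rfl).aestronglyMeasurable
    (hZ.mono (hs.filtration.le t) le_rfl).aestronglyMeasurable, hs.integral_batchInd hBK hN]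

variable {X : Dataset N d} {ℓ : ℝ → ℝ} {β : ℝ≥0} {η : ℝ} {w0 : EuclideanSpace ℝ (Fin d)}

theorem SamplingWithReplacement.measurable_sgd (hs : SamplingWithReplacement μ B batch)
    (hℓ : Continuous (deriv ℓ)) (t : ℕ) :
    Measurable[hs.filtration t] fun ω => sgd X ℓ η B (fun s => batch s ω) w0 t := by
  induction t with
  | zero => exact measurable_const
  | succ t ih =>
    have ih' := ih.mono (hs.filtration.mono t.le_succ) le_rfl
    simp only [sgd_succ]
    refine ih'.add ((measurable_const_smul (η / (B : ℝ))).comp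
      (Finset.measurable_sum _ fun n _ => ?_))
    refine Measurable.smul_const ((hs.measurable_batchInd t.lt_succ_self n).mul ?_) _
    exact (hℓ.measurable.comp (ih'.inner measurable_const)).neg

/-- At a fixed time the iterate is bounded over all batch sequences, since the derivative is
continuous on the ball reached before. This makes every continuous function of the iterate
integrable without moment estimates. -/
theorem exists_norm_sgd_le (hℓ : Continuous (deriv ℓ)) (t : ℕ) :
    ∃ C, ∀ b : ℕ → Finset (Fin N), ‖sgd X ℓ η B b w0 t‖ ≤ C := by
  induction t with
  | zero => exact ⟨‖w0‖, fun b => le_rfl⟩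
  | succ t ih =>
    obtain ⟨C, hC⟩ := ih
    have hD : ∀ n, ∃ D, ∀ w ∈ Metric.closedBall (0 : EuclideanSpace ℝ (Fin d)) C,
        ‖deriv ℓ (inner ℝ w (X n))‖ ≤ D := fun n =>
      (isCompact_closedBall _ _).exists_bound_of_continuousOn
        (hℓ.comp (continuous_id.inner continuous_const)).continuousOn
    choose D hD using hD
    refine ⟨C + |η / B| * ∑ n, D n * ‖X n‖, fun b => ?_⟩
    rw [sgd_succ]
    refine (norm_add_le _ _).trans (add_le_add (hC b) ?_)
    rw [norm_smul, Real.norm_eq_abs]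
    gcongr
    refine (norm_sum_le _ _).trans (Finset.sum_le_sum fun n _ => ?_)
    rw [norm_smul, norm_mul, norm_neg]
    have h1 := hD n _ (mem_closedBall_zero_iff.2 (hC b))
    have h2 : ‖batchInd (b t) n‖ ≤ 1 := by
      rw [Real.norm_eq_abs, abs_of_nonneg (batchInd_nonneg _ _)]
      exact batchInd_le_one _ _
    gcongr
    calc _ ≤ 1 * ‖deriv ℓ (inner ℝ (sgd X ℓ η B b w0 t) (X n))‖ := by gcongr
      _ ≤ D n := by rwa [one_mul]

theorem exists_abs_comp_sgd_le (hℓ : Continuous (deriv ℓ)) {φ : EuclideanSpace ℝ (Fin d) → ℝ}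
    (hφ : Continuous φ) (t : ℕ) :
    ∃ C, ∀ b : ℕ → Finset (Fin N), ‖φ (sgd X ℓ η B b w0 t)‖ ≤ C := by
  obtain ⟨C, hC⟩ := exists_norm_sgd_le (X := X) (η := η) (B := B) (w0 := w0) hℓ t
  obtain ⟨D, hD⟩ :=
    (isCompact_closedBall (0 : EuclideanSpace ℝ (Fin d)) C).exists_bound_of_continuousOn
    hφ.continuousOn
  exact ⟨D, fun b => hD _ (mem_closedBall_zero_iff.2 (hC b))⟩

theorem SamplingWithReplacement.integrable_comp_sgd [IsProbabilityMeasure μ]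
    (hs : SamplingWithReplacement μ B batch) (hℓ : Continuous (deriv ℓ))
    {φ : EuclideanSpace ℝ (Fin d) → ℝ} (hφ : Continuous φ) (t : ℕ) :
    Integrable (fun ω => φ (sgd X ℓ η B (fun s => batch s ω) w0 t)) μ := by
  obtain ⟨C, hC⟩ := exists_abs_comp_sgd_le (X := X) (η := η) (B := B) (w0 := w0) hℓ hφ t
  refine Integrable.of_bound (C := C) ?_ (Eventually.of_forall fun ω => hC _)
  exact (hφ.measurable.comp ((hs.measurable_sgd hℓ t).mono
    (hs.filtration.le t) le_rfl)).aestronglyMeasurable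

/-- If the expectations of nonnegative random variables are summable, then so are almost surely the
random variables. -/
theorem ae_summable_of_summable_integral {f : ℕ → Ω → ℝ} (hf0 : ∀ t ω, 0 ≤ f t ω)
    (hf : ∀ t, Integrable (f t) μ) (hsum : Summable fun t => ∫ ω, f t ω ∂μ) :
    ∀ᵐ ω ∂μ, Summable fun t => f t ω := by
  have hm : ∀ t, AEMeasurable (fun ω => ENNReal.ofReal (f t ω)) μ := fun t =>
    (hf t).aestronglyMeasurable.aemeasurable.ennreal_ofReal
  have h1 : ∫⁻ ω, ∑' t, ENNReal.ofReal (f t ω) ∂μ ≠ ⊤ := by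
    rw [lintegral_tsum hm]
    simp only [← ofReal_integral_eq_lintegral_ofReal (hf _) (Eventually.of_forall (hf0 _))]
    rw [← ENNReal.ofReal_tsum_of_nonneg (fun t => integral_nonneg (hf0 t)) hsum]
    exact ENNReal.ofReal_ne_top
  filter_upwards [ae_lt_top' (AEMeasurable.tsum hm) h1] with ω hω
  refine (ENNReal.summable_toReal hω.ne).congr fun t => ?_
  rw [ENNReal.toReal_ofReal (hf0 t ω)]

theorem negGrad_continuous (X : Dataset N d) (hℓ : Continuous (deriv ℓ)) :
    Continuous (negGrad X ℓ) := by
  unfold negGrad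
  refine continuous_finsetSum _ fun n _ => ?_
  exact ((hℓ.comp (continuous_id.inner continuous_const)).neg).smul continuous_const

/-- The loss decreases in expectation, so the gradients are square-summable in expectation. -/
theorem SamplingWithReplacement.summable_integral_negGrad [IsProbabilityMeasure μ]
    (hs : SamplingWithReplacement μ B batch) {K : ℕ} (hBK : B * K = N) (hN : 0 < N)
    (hX : LinearlySeparable X) (hℓ : IsSmoothMonotoneLoss ℓ β) (hη : 0 < η)
    (hstep : StepSizeWith X β η B) :
    Summable fun t => ∫ ω, ‖negGrad X ℓ (sgd X ℓ η B (fun s => batch s ω) w0 t)‖ ^ 2 ∂μ := by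
  have hB : 0 < B := Nat.pos_of_ne_zero (by rintro rfl; omega)
  have hK : 0 < K := Nat.pos_of_ne_zero (by rintro rfl; omega)
  have hK' : (0 : ℝ) < K := by exact_mod_cast hK
  have hγ := margin_pos hN hX
  have hσ := hγ.trans_le (margin_le_sigmaMax hN hX)
  have hβ := hℓ.smoothness_pos
  have hdc : Continuous (deriv ℓ) := hℓ.smooth.continuous
  have hGc := negGrad_continuous X hdc
  set h := η / B with hh
  have hh0 : 0 < h := by positivity
  set γ := margin X
  set σ := sigmaMax X
  set W : ℕ → Ω → EuclideanSpace ℝ (Fin d) := fun t ω => sgd X ℓ η B (fun s => batch s ω) w0 t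
  let f : Fin N → EuclideanSpace ℝ (Fin d) → ℝ := fun n w => -deriv ℓ (inner ℝ w (X n))
  have hfc : ∀ n, Continuous (f n) := fun n =>
    (hdc.comp (continuous_id.inner continuous_const)).neg
  -- Batch indicators equal their squares, so the second-order term too is linear in them. The
  -- change of the loss in one step is at most `∑ batchInd · ψ n`, whose expectation is that of `∑ ψ
  -- n` divided by `K`.
  let ψ : Fin N → EuclideanSpace ℝ (Fin d) → ℝ := fun n w =>
    -h * (f n w * inner ℝ (negGrad X ℓ w) (X n)) + β * σ ^ 2 / 2 * h ^ 2 * σ ^ 2 * f n w ^ 2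
  have hψc : ∀ n, Continuous (ψ n) := fun n =>
    (continuous_const.mul ((hfc n).mul (hGc.inner continuous_const))).add
      (continuous_const.mul ((hfc n).pow 2))
  -- Positivity of `c` is exactly the learning-rate condition.
  set c := h * (1 - β * σ ^ 4 * h / (2 * γ ^ 2)) with hc
  have hc0 : 0 < c := by
    unfold StepSizeWith at hstep
    rw [lt_div_iff₀ (by positivity)] at hstep
    refine mul_pos hh0 (sub_pos.2 ?_)
    rw [div_lt_one (by positivity)]
    calc _ = h * (β * σ ^ 2 * σ ^ 2) := by ring
      _ < _ := hstep
  have hψsum : ∀ w, ∑ n, ψ n w ≤ -c * ‖negGrad X ℓ w‖ ^ 2 := by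
    intro w
    have h1 : ∑ n, f n w * inner ℝ (negGrad X ℓ w) (X n) = ‖negGrad X ℓ w‖ ^ 2 := by
      rw [← real_inner_self_eq_norm_sq]
      conv_rhs => enter [3]; rw [negGrad]
      rw [inner_sum]
      exact Finset.sum_congr rfl fun n _ => by rw [inner_smul_right]
    have h2 : ∑ n, f n w ^ 2 ≤ ‖negGrad X ℓ w‖ ^ 2 / γ ^ 2 := by
      simpa [f] using sum_deriv_sq_le hℓ hN hX w
    simp only [ψ, Finset.sum_add_distrib, ← Finset.mul_sum]
    rw [h1]
    have h3 : β * σ ^ 2 / 2 * h ^ 2 * σ ^ 2 * ∑ n, f n w ^ 2 ≤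
        β * σ ^ 2 / 2 * h ^ 2 * σ ^ 2 * (‖negGrad X ℓ w‖ ^ 2 / γ ^ 2) := by gcongr
    have h4 : β * σ ^ 2 / 2 * h ^ 2 * σ ^ 2 * (‖negGrad X ℓ w‖ ^ 2 / γ ^ 2) =
        h * (β * σ ^ 4 * h / (2 * γ ^ 2)) * ‖negGrad X ℓ w‖ ^ 2 := by
      field_simp
    rw [hc]
    linarith
  have hpt : ∀ t ω, empLoss X ℓ (W (t + 1) ω) ≤
      empLoss X ℓ (W t ω) + ∑ n, batchInd (batch t ω) n * ψ n (W t ω) := by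
    intro t ω
    have h1 : W (t + 1) ω = W t ω + h • ∑ n, (batchInd (batch t ω) n * f n (W t ω)) • X n :=
      sgd_succ X ℓ η B _ w0 t
    rw [h1]
    refine (empLoss_add_le hℓ X _ _).trans ?_
    have h2 := norm_sum_smul_sq_le_sigmaMax X fun n => batchInd (batch t ω) n * f n (W t ω)
    simp only [mul_pow, batchInd_sq] at h2
    rw [norm_smul, mul_pow, Real.norm_eq_abs, sq_abs]
    have h3 : β * σ ^ 2 / 2 * (h ^ 2 * ‖∑ n, (batchInd (batch t ω) n * f n (W t ω)) • X n‖ ^ 2) ≤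
        β * σ ^ 2 / 2 * (h ^ 2 * (σ ^ 2 * ∑ n, batchInd (batch t ω) n * f n (W t ω) ^ 2)) := by
      gcongr
    refine (add_le_add_right h3 _).trans (le_of_eq ?_)
    rw [inner_smul_right, inner_sum, sub_add, sub_eq_add_neg]
    congr 1
    simp only [ψ, mul_add, Finset.sum_add_distrib, Finset.mul_sum, inner_smul_right]
    rw [neg_sub, sub_eq_neg_add, ← Finset.sum_neg_distrib]
    congr 1
    · exact Finset.sum_congr rfl fun n _ => by ring
    · exact Finset.sum_congr rfl fun n _ => by ring
  have hLc : Continuous (empLoss X ℓ) := continuous_finsetSum _ fun n _ =>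
    hℓ.differentiable.continuous.comp (continuous_id.inner continuous_const)
  have hint : ∀ {φ : EuclideanSpace ℝ (Fin d) → ℝ}, Continuous φ → ∀ t,
      Integrable (fun ω => φ (W t ω)) μ := fun hφ t => hs.integrable_comp_sgd hdc hφ t
  have hWm := fun t => hs.measurable_sgd (X := X) (η := η) (w0 := w0) hdc t
  have hint2 : ∀ t n, Integrable (fun ω => batchInd (batch t ω) n * ψ n (W t ω)) μ := by
    intro t n
    refine (hint (hψc n) t).bdd_mul (c := 1) ?_ (Eventually.of_forall fun ω => ?_)
    · exact ((hs.measurable_batchInd t.lt_succ_self n).mono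
        (hs.filtration.le _) le_rfl).aestronglyMeasurable
    · rw [Real.norm_eq_abs, abs_of_nonneg (batchInd_nonneg _ _)]
      exact batchInd_le_one _ _
  have hE : ∀ t, ∫ ω, empLoss X ℓ (W (t + 1) ω) ∂μ ≤ ∫ ω, empLoss X ℓ (W t ω) ∂μ
      - c / K * ∫ ω, ‖negGrad X ℓ (W t ω)‖ ^ 2 ∂μ := by
    intro t
    calc _ ≤ ∫ ω, (empLoss X ℓ (W t ω) + ∑ n, batchInd (batch t ω) n * ψ n (W t ω)) ∂μ :=
          integral_mono (hint hLc _)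
            ((hint hLc t).add (integrable_finsetSum _ fun n _ => hint2 t n)) (hpt t)
      _ = ∫ ω, empLoss X ℓ (W t ω) ∂μ + 1 / K * ∫ ω, ∑ n, ψ n (W t ω) ∂μ := by
          rw [integral_add (hint hLc t) (integrable_finsetSum _ fun n _ => hint2 t n),
            integral_finsetSum _ fun n _ => hint2 t n,
            integral_finsetSum _ fun n _ => hint (hψc n) t, Finset.mul_sum]
          congr 1
          exact Finset.sum_congr rfl fun n _ => hs.integral_batchInd_mul hBK hN t n
            ((hψc n).measurable.comp (hWm t))
      _ ≤ ∫ ω, empLoss X ℓ (W t ω) ∂μ +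
          1 / K * ∫ ω, -c * ‖negGrad X ℓ (W t ω)‖ ^ 2 ∂μ := by
          refine add_le_add le_rfl (mul_le_mul_of_nonneg_left ?_ (by positivity))
          exact integral_mono (integrable_finsetSum _ fun n _ => hint (hψc n) t)
            ((hint (hGc.norm.pow 2) t).const_mul _) fun ω => hψsum _
      _ = _ := by
          rw [integral_const_mul]
          ring
  refine summable_of_sum_range_le (c := (∫ ω, empLoss X ℓ (W 0 ω) ∂μ) / (c / K))
    (fun t => integral_nonneg fun ω => by positivity) fun n => ?_
  have : c / K * ∑ t ∈ Finset.range n, ∫ ω, ‖negGrad X ℓ (W t ω)‖ ^ 2 ∂μ ≤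
      ∫ ω, empLoss X ℓ (W 0 ω) ∂μ - ∫ ω, empLoss X ℓ (W n ω) ∂μ := by
    induction n with
    | zero => simp
    | succ n ih => rw [Finset.sum_range_succ, mul_add]; linarith [hE n]
  rw [le_div_iff₀ (by positivity), mul_comm]
  have h0 : 0 ≤ ∫ ω, empLoss X ℓ (W n ω) ∂μ := integral_nonneg fun ω => empLoss_nonneg hℓ X _
  linarith

/-- The centred sampling noise, weighted by predictable coefficients with summable second moments,
converges almost surely. -/
theorem SamplingWithReplacement.ae_tendsto_noise [IsProbabilityMeasure μ]
    (hs : SamplingWithReplacement μ B batch) {K : ℕ} (hBK : B * K = N) (hN : 0 < N)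
    {Z : ℕ → Ω → ℝ} (hZ : ∀ t, Measurable[hs.filtration t] (Z t))
    (hbd : ∀ t, ∃ C, ∀ ω, ‖Z t ω‖ ≤ C) (hsum : Summable fun t => ∫ ω, Z t ω ^ 2 ∂μ)
    (n : Fin N) :
    ∀ᵐ ω ∂μ, ∃ m, Tendsto
      (fun t => ∑ s ∈ Finset.range t, (batchInd (batch s ω) n - 1 / K) * Z s ω) atTop (𝓝 m) := by
  have hK : 0 < K := Nat.pos_of_ne_zero (by rintro rfl; omega)
  have hK' : (1 : ℝ) ≤ K := by exact_mod_cast hK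
  have hKinv : 1 / (K : ℝ) ≤ 1 := by rw [div_le_one (by positivity)]; exact hK'
  have hKinv0 : 0 ≤ 1 / (K : ℝ) := by positivity
  let ξ : ℕ → Ω → ℝ := fun t ω => batchInd (batch t ω) n - 1 / K
  have hξabs : ∀ t ω, |ξ t ω| ≤ 1 := fun t ω => by
    have h1 := batchInd_nonneg (batch t ω) n
    have h2 := batchInd_le_one (batch t ω) n
    rw [abs_le]
    constructor <;> simp only [ξ] <;> linarith
  have hξm : ∀ {s t}, s < t → Measurable[hs.filtration t] (ξ s) := fun hst =>
    (hs.measurable_batchInd hst n).sub_const _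
  let M : ℕ → Ω → ℝ := fun t ω => ∑ s ∈ Finset.range t, ξ s ω * Z s ω
  have hMsucc : ∀ t ω, M (t + 1) ω = M t ω + ξ t ω * Z t ω := fun t ω =>
    Finset.sum_range_succ _ _
  have hMm : ∀ t, Measurable[hs.filtration t] (M t) := fun t => by
    refine Finset.measurable_sum _ fun s hst => ?_
    rw [Finset.mem_range] at hst
    exact (hξm hst).mul ((hZ s).mono (hs.filtration.mono hst.le) le_rfl)
  have hMbd : ∀ t, ∃ C, ∀ ω, ‖M t ω‖ ≤ C := fun t => by
    choose C hC using hbd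
    refine ⟨∑ s ∈ Finset.range t, C s, fun ω => ?_⟩
    refine (norm_sum_le _ _).trans (Finset.sum_le_sum fun s _ => ?_)
    rw [norm_mul]
    calc _ ≤ 1 * ‖Z s ω‖ := by gcongr; exact hξabs s ω
      _ ≤ C s := by rw [one_mul]; exact hC s ω
  have hint : ∀ {t : ℕ} {Y : Ω → ℝ}, Measurable[hs.filtration t] Y → (∃ C, ∀ ω, ‖Y ω‖ ≤ C) →
      Integrable Y μ := fun {t Y} hY ⟨C, hC⟩ =>
    Integrable.of_bound (C := C)
      (hY.mono (hs.filtration.le t) le_rfl).aestronglyMeasurable (Eventually.of_forall hC)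
  have hbdmul : ∀ {Y Y' : Ω → ℝ}, (∃ C, ∀ ω, ‖Y ω‖ ≤ C) → (∃ C, ∀ ω, ‖Y' ω‖ ≤ C) →
      ∃ C, ∀ ω, ‖Y ω * Y' ω‖ ≤ C := fun ⟨C, hC⟩ ⟨C', hC'⟩ =>
    ⟨C * C', fun ω => by
      rw [norm_mul]
      exact mul_le_mul (hC ω) (hC' ω) (norm_nonneg _) ((norm_nonneg _).trans (hC ω))⟩
  have hξbd : ∀ t, ∃ C, ∀ ω, ‖ξ t ω‖ ≤ C := fun t => ⟨1, hξabs t⟩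
  have hcentre : ∀ t {Y : Ω → ℝ}, Measurable[hs.filtration t] Y → (∃ C, ∀ ω, ‖Y ω‖ ≤ C) →
      ∫ ω, ξ t ω * Y ω ∂μ = 0 := by
    intro t Y hY hYb
    have h1 : Integrable (fun ω => batchInd (batch t ω) n * Y ω) μ :=
      hint ((hs.measurable_batchInd t.lt_succ_self n).mul
        (hY.mono (hs.filtration.mono t.le_succ) le_rfl))
        (hbdmul ⟨1, fun ω => by
          rw [Real.norm_eq_abs, abs_of_nonneg (batchInd_nonneg _ _)]
          exact batchInd_le_one _ _⟩ hYb)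
    simp only [ξ, sub_mul]
    rw [integral_sub h1 ((hint hY hYb).const_mul _), hs.integral_batchInd_mul hBK hN t n hY,
      integral_const_mul, sub_self]
  have hmart : Martingale M hs.filtration μ := by
    refine martingale_of_setIntegral_eq_succ (fun t => (hMm t).stronglyMeasurable)
      (fun t => hint (hMm t) (hMbd t)) fun t S hS => ?_
    have hS' := hs.filtration.le t S hS
    have h1 : Measurable[hs.filtration t] (S.indicator (Z t)) := (hZ t).indicator hS
    have h2 : ∃ C, ∀ ω, ‖S.indicator (Z t) ω‖ ≤ C := by
      obtain ⟨C, hC⟩ := hbd t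
      exact ⟨C, fun ω => (norm_indicator_le_norm_self _ _).trans (hC ω)⟩
    -- Restricting `Z t` to a past event keeps it predictable, so the centring applies.
    have h3 : ∫ ω in S, ξ t ω * Z t ω ∂μ = 0 := by
      rw [← integral_indicator hS', ← hcentre t h1 h2]
      refine integral_congr_ae (Eventually.of_forall fun ω => ?_)
      by_cases hω : ω ∈ S <;> simp [hω]
    simp only [hMsucc]
    rw [integral_add (hint (hMm t) (hMbd t)).integrableOn, h3, add_zero]
    exact (hint ((hξm t.lt_succ_self).mul ((hZ t).mono (hs.filtration.mono t.le_succ) le_rfl))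
      (hbdmul (hξbd t) (hbd t))).integrableOn
  -- Orthogonality of martingale increments: the cross term is centred noise times the predictable
  -- `M t * Z t`, and `|ξ| ≤ 1`.
  have hsq : ∀ t, ∫ ω, M t ω ^ 2 ∂μ ≤ ∑ s ∈ Finset.range t, ∫ ω, Z s ω ^ 2 ∂μ := by
    intro t
    induction t with
    | zero => simp [M]
    | succ t ih =>
      have hZ' := (hZ t).mono (hs.filtration.mono t.le_succ) le_rfl
      have hM' := (hMm t).mono (hs.filtration.mono t.le_succ) le_rfl
      have i1 : Integrable (fun ω => M t ω ^ 2) μ := by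
        simp only [sq]
        exact hint ((hMm t).mul (hMm t)) (hbdmul (hMbd t) (hMbd t))
      have i2 : Integrable (fun ω => Z t ω ^ 2) μ := by
        simp only [sq]
        exact hint ((hZ t).mul (hZ t)) (hbdmul (hbd t) (hbd t))
      have i3 : Integrable (fun ω => ξ t ω * (M t ω * Z t ω)) μ :=
        hint ((hξm t.lt_succ_self).mul (hM'.mul hZ'))
          (hbdmul (hξbd t) (hbdmul (hMbd t) (hbd t)))
      have i4 : Integrable (fun ω => M (t + 1) ω ^ 2) μ := by
        simp only [sq]
        exact hint ((hMm _).mul (hMm _)) (hbdmul (hMbd _) (hMbd _))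
      rw [Finset.sum_range_succ]
      calc ∫ ω, M (t + 1) ω ^ 2 ∂μ
          ≤ ∫ ω, (M t ω ^ 2 + Z t ω ^ 2 + 2 * (ξ t ω * (M t ω * Z t ω))) ∂μ := by
            refine integral_mono i4 ((i1.add i2).add (i3.const_mul 2)) fun ω => ?_
            have h1 : ξ t ω ^ 2 ≤ 1 := by
              rw [← sq_abs]
              exact pow_le_one₀ (abs_nonneg _) (hξabs t ω)
            have h2 := mul_le_mul_of_nonneg_right h1 (sq_nonneg (Z t ω))
            simp only [hMsucc]
            nlinarith
        _ = ∫ ω, M t ω ^ 2 ∂μ + ∫ ω, Z t ω ^ 2 ∂μ := by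
            rw [integral_add (f := fun ω => M t ω ^ 2 + Z t ω ^ 2) (i1.add i2)
              (i3.const_mul 2), integral_add i1 i2,
              integral_const_mul, hcentre t (Y := fun ω => M t ω * Z t ω) ((hMm t).mul (hZ t))
                (hbdmul (hMbd t) (hbd t))]
            ring
        _ ≤ _ := by gcongr
  have hnonneg : ∀ t, 0 ≤ ∫ ω, Z t ω ^ 2 ∂μ := fun t => integral_nonneg fun ω => sq_nonneg _
  -- The convergence theorem asks for an `L¹` bound, which follows from the `L²` bound by `|x| ≤ 1 +
  -- x²`.
  refine hmart.submartingale.exists_ae_tendsto_of_bdd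
    (R := (1 + ∑' t, ∫ ω, Z t ω ^ 2 ∂μ).toNNReal) fun t => ?_
  have hMint := hint (hMm t) (hMbd t)
  have i1 : Integrable (fun ω => M t ω ^ 2) μ := by
    simp only [sq]
    exact hint ((hMm t).mul (hMm t)) (hbdmul (hMbd t) (hMbd t))
  rw [eLpNorm_one_eq_lintegral_enorm, ← ofReal_integral_norm_eq_lintegral_enorm hMint]
  refine ENNReal.ofReal_le_ofReal ?_
  calc ∫ ω, ‖M t ω‖ ∂μ ≤ ∫ ω, (1 + M t ω ^ 2) ∂μ := by
        refine integral_mono hMint.norm ((integrable_const _).add i1) fun ω => ?_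
        rw [Real.norm_eq_abs, ← sq_abs]
        nlinarith [sq_nonneg (|M t ω| - 1), abs_nonneg (M t ω)]
    _ = 1 + ∫ ω, M t ω ^ 2 ∂μ := by rw [integral_add (integrable_const _) i1]; simp
    _ ≤ _ := by
        gcongr
        exact (hsq t).trans (hsum.sum_le_tsum _ fun s _ => hnonneg s)

theorem ae_hasLogAsymptotics_of_caseWith [IsProbabilityMeasure μ] (hN : 0 < N)
    {what wtilde : EuclideanSpace ℝ (Fin d)} {α : Fin N → ℝ}
    (H : IsRegularLimit X what α w0 wtilde)
    (hℓ : IsSmoothMonotoneLoss ℓ β) (htail : HasTightExpTail (fun u => -deriv ℓ u)) {K : ℕ}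
    (hcase : CaseWith μ X β η B K batch) :
    ∀ᵐ ω ∂μ, HasLogAsymptotics (sgd X ℓ η B (fun t => batch t ω) w0) what wtilde η B K := by
  obtain ⟨hη, hBK, hstep, hs⟩ := hcase
  have hX := H.linearlySeparable
  have hB : 0 < B := Nat.pos_of_ne_zero (by rintro rfl; omega)
  have hK : 0 < K := Nat.pos_of_ne_zero (by rintro rfl; omega)
  have hdc : Continuous (deriv ℓ) := hℓ.smooth.continuous
  have hsum := hs.summable_integral_negGrad (w0 := w0) hBK hN hX hℓ hη hstep
  have hGint := fun t => hs.integrable_comp_sgd (X := X) (η := η) (w0 := w0) hdc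
    ((negGrad_continuous X hdc).norm.pow 2) t
  have hG := ae_summable_of_summable_integral (fun t ω => sq_nonneg _) hGint hsum
  have hM : ∀ n, ∀ᵐ ω ∂μ, ∃ m, Tendsto (fun t => ∑ s ∈ Finset.range t,
      (batchInd (batch s ω) n - 1 / K) *
        -deriv ℓ (inner ℝ (sgd X ℓ η B (fun t => batch t ω) w0 s) (X n))) atTop (𝓝 m) := by
    intro n
    have hfc : Continuous fun w : EuclideanSpace ℝ (Fin d) => -deriv ℓ (inner ℝ w (X n)) :=
      (hdc.comp (continuous_id.inner continuous_const)).neg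
    refine hs.ae_tendsto_noise hBK hN
      (Z := fun t ω => -deriv ℓ (inner ℝ (sgd X ℓ η B (fun t => batch t ω) w0 t) (X n)))
      (fun t => hfc.measurable.comp (hs.measurable_sgd hdc t)) (fun t => ?_) ?_ n
    · obtain ⟨C, hC⟩ := exists_abs_comp_sgd_le (X := X) (η := η) (B := B) (w0 := w0) hdc hfc t
      exact ⟨C, fun ω => hC _⟩
    · refine Summable.of_nonneg_of_le (fun t => integral_nonneg fun ω => sq_nonneg _) (fun t => ?_)
        (hsum.div_const (margin X ^ 2))
      rw [← integral_div]
      refine integral_mono (hs.integrable_comp_sgd hdc (hfc.pow 2) t)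
        ((hGint t).div_const _) fun ω => ?_
      refine le_trans ?_ (sum_deriv_sq_le hℓ hN hX (sgd X ℓ η B (fun t => batch t ω) w0 t))
      simp only [neg_sq]
      exact Finset.single_le_sum (f := fun n =>
        deriv ℓ (inner ℝ (sgd X ℓ η B (fun t => batch t ω) w0 t) (X n)) ^ 2)
        (fun n _ => sq_nonneg _) (Finset.mem_univ n)
  filter_upwards [hG, ae_all_iff.2 hM] with ω h1 h2
  exact hasLogAsymptotics_of_noise hN H hℓ htail (by positivity) hK h1 h2

end Random

end MinibatchSGD

/-! ### Assembly. -/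

open MinibatchSGD in
theorem corollary1 {N d : ℕ} (hN : 0 < N) :
    ∀ᵐ X : Dataset N d, LinearlySeparable X →
      ∃ (what : EuclideanSpace ℝ (Fin d)) (α : Fin N → ℝ),
        (IsMaxMarginSeparator X what ∧ ∀ v, IsMaxMarginSeparator X v → v = what) ∧
        (IsSVMDual X what α ∧ ∀ a, IsSVMDual X what a → a = α) ∧
        (SupportVectorsSpan X what → ∀ w0 : EuclideanSpace ℝ (Fin d),
          ∃ wtilde : EuclideanSpace ℝ (Fin d),
            (IsResidualLimit X what α w0 wtilde ∧
              ∀ v, IsResidualLimit X what α w0 v → v = wtilde) ∧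
            ∀ (ℓ : ℝ → ℝ) (β : ℝ≥0), IsSmoothMonotoneLoss ℓ β →
              HasTightExpTail (fun u => -deriv ℓ u) →
              -- random sampling with replacement: almost surely
              (∀ (Ω : Type*) [MeasurableSpace Ω] (μ : Measure Ω) [IsProbabilityMeasure μ]
                (η : ℝ) (B K : ℕ) (batch : ℕ → Ω → Finset (Fin N)),
                CaseWith μ X β η B K batch →
                ∀ᵐ ω ∂μ, HasLogAsymptotics (sgd X ℓ η B (fun t => batch t ω) w0)
                  what wtilde η B K) ∧
              -- sampling without replacement: surely
              (∀ (η : ℝ) (B K : ℕ) (batch : ℕ → Finset (Fin N)),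
                CaseWithout X β η B K batch →
                HasLogAsymptotics (sgd X ℓ η B batch w0) what wtilde η B K) ∧
              -- proportional step sizes: the number of minibatches only rescales time;
              -- almost surely, for runs in either sampling regime
              (∀ (Ω : Type*) [MeasurableSpace Ω] (μ : Measure Ω) [IsProbabilityMeasure μ]
                (η₁ η₂ : ℝ) (B₁ B₂ K₁ K₂ : ℕ) (batch₁ batch₂ : ℕ → Ω → Finset (Fin N)),
                (CaseWith μ X β η₁ B₁ K₁ batch₁ ∨
                  ∀ ω, CaseWithout X β η₁ B₁ K₁ (fun t => batch₁ t ω)) →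
                (CaseWith μ X β η₂ B₂ K₂ batch₂ ∨
                  ∀ ω, CaseWithout X β η₂ B₂ K₂ (fun t => batch₂ t ω)) →
                η₁ / B₁ = η₂ / B₂ →
                ∀ᵐ ω ∂μ, AgreePerEpoch (sgd X ℓ η₁ B₁ (fun t => batch₁ t ω) w0)
                  (sgd X ℓ η₂ B₂ (fun t => batch₂ t ω) w0) K₁ K₂) ∧
              -- surely, for two runs without replacement
              (∀ (η₁ η₂ : ℝ) (B₁ B₂ K₁ K₂ : ℕ) (batch₁ batch₂ : ℕ → Finset (Fin N)),
                CaseWithout X β η₁ B₁ K₁ batch₁ → CaseWithout X β η₂ B₂ K₂ batch₂ →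
                η₁ / B₁ = η₂ / B₂ →
                AgreePerEpoch (sgd X ℓ η₁ B₁ batch₁ w0) (sgd X ℓ η₂ B₂ batch₂ w0) K₁ K₂)) := by
  filter_upwards [ae_exists_pos_dual (N := N) (d := d) hN] with X hX hsep
  obtain ⟨what, α, hone, hdual, hpos, hli⟩ := hX hsep
  refine ⟨what, α, hdual.isMaxMarginSeparator hone, ⟨hdual, fun a ha => hdual.unique ha hli⟩,
    fun hspan w0 => ?_⟩
  obtain ⟨wtilde, hres, huniq⟩ := exists_unique_residualLimit hpos hli w0
  have H : IsRegularLimit X what α w0 wtilde :=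
    { one_le := hone
      dual := hdual
      pos := hpos
      mem_span := hspan.mem_supportSpan
      exp_eq := hres.1
      start_mem := by
        rw [← neg_sub]
        exact Submodule.neg_mem _ hres.sub_mem }
  have hBpos : ∀ {η : ℝ} {B K : ℕ}, 0 < η → B * K = N → 0 < η / B ∧ 0 < K := by
    intro η B K hη hBK
    have hB : 0 < B := Nat.pos_of_ne_zero (by rintro rfl; omega)
    have hK : 0 < K := Nat.pos_of_ne_zero (by rintro rfl; omega)
    exact ⟨by positivity, hK⟩
  refine ⟨wtilde, ⟨hres, huniq⟩, fun ℓ β hℓ htail => ⟨?_, ?_, ?_, ?_⟩⟩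
  · intro Ω _ μ _ η B K batch hcase
    exact ae_hasLogAsymptotics_of_caseWith hN H hℓ htail hcase
  · intro η B K batch hcase
    exact hasLogAsymptotics_of_caseWithout hN H hℓ htail hcase
  · intro Ω _ μ _ η₁ η₂ B₁ B₂ K₁ K₂ batch₁ batch₂ h₁ h₂ heq
    have hrun : ∀ {η : ℝ} {B K : ℕ} {batch : ℕ → Ω → Finset (Fin N)},
        (CaseWith μ X β η B K batch ∨ ∀ ω, CaseWithout X β η B K (fun t => batch t ω)) →
        (∀ᵐ ω ∂μ, HasLogAsymptotics (sgd X ℓ η B (fun t => batch t ω) w0) what wtilde η B K) ∧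
          0 < η / B ∧ 0 < K := by
      rintro η B K batch (h | h)
      · exact ⟨ae_hasLogAsymptotics_of_caseWith hN H hℓ htail h, hBpos h.1 h.2.1⟩
      -- The conditions on `η`, `B`, `K` are stated under `∀ ω`, so some outcome is needed to
      -- extract them.
      · obtain ⟨ω⟩ := nonempty_of_isProbabilityMeasure μ
        exact ⟨Eventually.of_forall fun ω =>
          hasLogAsymptotics_of_caseWithout hN H hℓ htail (h ω), hBpos (h ω).1 (h ω).2.1⟩
    obtain ⟨a₁, hη₁, hK₁⟩ := hrun h₁
    obtain ⟨a₂, -, hK₂⟩ := hrun h₂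
    filter_upwards [a₁, a₂] with ω l₁ l₂
    exact AgreePerEpoch.of_hasLogAsymptotics l₁ l₂ hK₁ hK₂ hη₁ heq
  · intro η₁ η₂ B₁ B₂ K₁ K₂ batch₁ batch₂ h₁ h₂ heq
    obtain ⟨hη₁, hK₁⟩ := hBpos h₁.1 h₁.2.1
    obtain ⟨-, hK₂⟩ := hBpos h₂.1 h₂.2.1
    exact AgreePerEpoch.of_hasLogAsymptotics
      (hasLogAsymptotics_of_caseWithout hN H hℓ htail h₁)
      (hasLogAsymptotics_of_caseWithout hN H hℓ htail h₂) hK₁ hK₂ hη₁ heq
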